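/- Let $\gamma$ be the Euler constant, $b_n=\bigl[2\log\frac{n}{\sqrt{\pi\log n}}\bigr]^{1/2}$, and for a sequence $\xi=(\xi_1,\xi_2,\dots)$ of i.i.d. standard Gaussian random variables let $\Sigma_n(\xi)=\frac1n\sum_{i=1}^n\exp(\xi_i^2/2)$. For a sequence $e_1,e_2,\dots$ of i.i.d. standard exponential random variables let $$\zeta^\circ=\sum_{k=1}^\infty\Bigl[\Bigl(\sum_{s=1}^k e_s\Bigr)^{-1}-\frac1k\Bigr]+\gamma ,$$ where the series converges absolutely almost surely. Then, as $n\to\infty$, $$\Sigma_n(\xi)\stackrel{\mathbf P}{=}\sqrt{\frac2\pi}\Bigl(b_n+\frac{\zeta^\circ}{b_n}\Bigr)+o\Bigl(\frac1{\sqrt{\log n}}\Bigr)$$ in the sense of coupling on a common probability space. Precisely: (a) there is a probability space carrying one i.i.d. standard exponential sequence $(e_s)$, with its variable $\zeta^\circ$, and for each $n$ an i.i.d. standard Gaussian sequence $\xi^{(n)}$, such that for every $\varepsilon>0$ $$\lim_{n\to\infty}\mathbf P\Bigl\{\sqrt{\log n}\,\Bigl|\Sigma_n(\xi^{(n)})-\sqrt{\tfrac2\pi}\Bigl(b_n+\frac{\zeta^\circ}{b_n}\Bigr)\Bigr|\ge\varepsilon\Bigr\}=0;$$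 (b) there is a probability space carrying one i.i.d. standard Gaussian sequence $\xi$, and for each $n$ an i.i.d. standard exponential sequence $(e^{(n)}_s)_s$, with its variable $\zeta^{\circ}_{n}$ (distributed as $\zeta^\circ$), such that for every $\varepsilon>0$ $$\lim_{n\to\infty}\mathbf P\Bigl\{\sqrt{\log n}\,\Bigl|\Sigma_n(\xi)-\sqrt{\tfrac2\pi}\Bigl(b_n+\frac{\zeta^\circ_n}{b_n}\Bigr)\Bigr|\ge\varepsilon\Bigr\}=0.$$ -/

import Mathlib

open MeasureTheory ProbabilityTheory Filter Topology

noncomputable section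

/-- `X 0, X 1, …` are independent under `μ`, each with distribution `ν`. -/
def IsIID {Ω : Type*} [MeasurableSpace Ω] (X : ℕ → Ω → ℝ) (ν : Measure ℝ) (μ : Measure Ω) :
    Prop :=
  (∀ i, HasLaw (X i) ν μ) ∧ iIndepFun X μ

/-- `Σ_n(x) = (1/n) ∑_{i ≤ n} exp(x_i² / 2)`; the sequence `x` is indexed from `0`. -/
def sigmaSum (n : ℕ) (x : ℕ → ℝ) : ℝ :=
  (1 / (n : ℝ)) * ∑ i ∈ Finset.range n, Real.exp (x i ^ 2 / 2)

/-- `b_n = [2 log (n / √(π log n))]^{1/2}`. -/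
def bSeq (n : ℕ) : ℝ :=
  Real.sqrt (2 * Real.log ((n : ℝ) / Real.sqrt (Real.pi * Real.log (n : ℝ))))

/-- The summand `(e_1 + ⋯ + e_{k+1})⁻¹ - 1/(k+1)`; the sequence `e` is indexed from `0`, and the
summation index `k` is shifted by one. -/
def zetaTerm (e : ℕ → ℝ) (k : ℕ) : ℝ :=
  (∑ s ∈ Finset.range (k + 1), e s)⁻¹ - 1 / ((k : ℝ) + 1)

/-- `ζ° = ∑_{k ≥ 1} [(e_1 + ⋯ + e_k)⁻¹ - 1/k] + γ`, with `γ` the Euler constant. -/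
def zetaCirc (e : ℕ → ℝ) : ℝ :=
  (∑' k, zetaTerm e k) + Real.eulerMascheroniConstant

/-- `κ_n = κ'_n + o(r_n)` in probability, for random variables on one probability space. -/
def EqInProbUpTo {Ω : Type*} [MeasurableSpace Ω] (μ : Measure Ω) (κ κ' : ℕ → Ω → ℝ)
    (r : ℕ → ℝ) : Prop :=
  ∀ ε : ℝ, 0 < ε → Tendsto (fun n => μ {ω | ε ≤ |κ n ω - κ' n ω| / r n}) atTop (𝓝 0)

end

/-!
The exponential mean `Σ_n(ξ)` is a symmetric function of the tail probabilities
`U_i = P(|ξ| > |ξ_i|)`, which are independent and uniform: `exp(ξ_i² / 2) = H(U_i)` with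
`H = expQuantile`. As an unordered sample, `n` uniform variables are distributed like
`Γ_1/Γ_{n+1}, …, Γ_n/Γ_{n+1}`, where `Γ_k = e_1 + ⋯ + e_k` (`lintegral_normalized_partialSums`).
Hence `Σ_n(ξ)` has the law of `arrivalMean n e = (1/n) ∑_{k ≤ n} H(Γ_k/Γ_{n+1})`.

The function `arrivalMean` is treated for a fixed arrival sequence. The Mills ratio gives
`H(u) ~ 1 / (u √(π log(1/u)))` as `u → 0`, so with `N = Γ_{n+1}` the scaled summand
`(√(π log N) / N) H(Γ_k/N)` tends to `1/Γ_k`, while the scaled integral of `N H` over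
`[k/N, (k+1)/N]` tends to `log((k+1)/k)`. The differences are dominated by a multiple of
`(|Γ_k - k| + 1) k^{-7/4}` uniformly in `N` (`exists_expQuantile_sub_majorant`), and this is almost
surely summable because `E|Γ_k - k| ≤ √k`. By dominated convergence the centred sum tends to
`∑ (1/Γ_k - log((k+1)/k)) = ζ°`. The integrals telescope to `√(2/π)` times the half-normal
quantile at `1/N`, which differs from `b_n` by `o(1/√(log n))` if `Γ_{n+1}/n - 1 = o(1/log n)`.
The last condition holds in probability, so almost surely along subsequences, and
`arrivalMean n e = √(2/π) (b_n + ζ°/b_n) + o(1/√(log n))` in probability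
(`IsIID.eqInProbUpTo_arrivalMean`).

For both couplings it remains to realize the equality in law of `Σ_n(ξ)` and `arrivalMean n e` as an
almost sure equality, for all `n` on one probability space and with one of the two sequences fixed
(`exists_coupling`): the other sequence is drawn from its conditional law given the common value.
-/

/-! ### The tail of the half-normal distribution -/

/-- The tail `P(|ξ| > x) = 1 - √(2/π) ∫₀ˣ exp(-t²/2) dt` of the absolute value of a standard
Gaussian variable, for `x ≥ 0`; the formula makes sense, and is used, for all real `x`. -/
noncomputable def halfNormalTail (x : ℝ) : ℝ :=
  1 - √(2 / Real.pi) * ∫ t in (0 : ℝ)..x, Real.exp (-(t ^ 2 / 2))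

lemma hasDerivAt_halfNormalTail (x : ℝ) :
    HasDerivAt halfNormalTail (-(√(2 / Real.pi) * Real.exp (-(x ^ 2 / 2)))) x := by
  have hc : Continuous fun t : ℝ => Real.exp (-(t ^ 2 / 2)) := by fun_prop
  have h := intervalIntegral.integral_hasDerivAt_right (hc.intervalIntegrable 0 x)
    (hc.stronglyMeasurableAtFilter _ _) hc.continuousAt
  exact (h.const_mul _).const_sub 1

lemma continuous_halfNormalTail : Continuous halfNormalTail :=
  continuous_iff_continuousAt.2 fun x => (hasDerivAt_halfNormalTail x).continuousAt

lemma strictAnti_halfNormalTail : StrictAnti halfNormalTail := by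
  refine strictAnti_of_deriv_neg fun x => ?_
  rw [(hasDerivAt_halfNormalTail x).deriv]
  have : 0 < √(2 / Real.pi) := by positivity
  have := Real.exp_pos (-(x ^ 2 / 2))
  simp only [Left.neg_neg_iff]
  positivity

lemma halfNormalTail_zero : halfNormalTail 0 = 1 := by simp [halfNormalTail]

lemma tendsto_halfNormalTail : Tendsto halfNormalTail atTop (𝓝 0) := by
  have e : (fun t : ℝ => Real.exp (-(t ^ 2 / 2))) = fun t => Real.exp (-(1 / 2) * t ^ 2) := by
    funext t; ring_nf
  have hi : Integrable fun t : ℝ => Real.exp (-(t ^ 2 / 2)) := by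
    rw [e]; exact integrable_exp_neg_mul_sq (by norm_num)
  have h := intervalIntegral_tendsto_integral_Ioi (0 : ℝ) hi.integrableOn tendsto_id
  have h2 := (h.const_mul (√(2 / Real.pi))).const_sub 1
  have e2 : √(2 / Real.pi) * ∫ t in Set.Ioi (0 : ℝ), Real.exp (-(t ^ 2 / 2)) = 1 := by
    rw [e, integral_gaussian_Ioi]
    have : Real.pi / (1 / 2) = Real.pi * 2 := by ring
    rw [this, ← mul_div_assoc, ← Real.sqrt_mul (by positivity)]
    have : 2 / Real.pi * (Real.pi * 2) = 2 ^ 2 := by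
      field_simp
    rw [this, Real.sqrt_sq (by norm_num)]
    norm_num
  rw [e2, sub_self] at h2
  exact h2

lemma halfNormalTail_pos (x : ℝ) : 0 < halfNormalTail x := by
  have h1 : halfNormalTail (x + 1) < halfNormalTail x := strictAnti_halfNormalTail (by linarith)
  have h2 : 0 ≤ halfNormalTail (x + 1) :=
    strictAnti_halfNormalTail.antitone.le_of_tendsto tendsto_halfNormalTail _
  linarith

lemma halfNormalTail_le_one {x : ℝ} (hx : 0 ≤ x) : halfNormalTail x ≤ 1 :=
  halfNormalTail_zero ▸ strictAnti_halfNormalTail.antitone hx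

lemma halfNormalTail_sub_bounds {x y : ℝ} (hx : 0 ≤ x) (hxy : x ≤ y) :
    √(2 / Real.pi) * (y - x) * Real.exp (-(y ^ 2 / 2)) ≤ halfNormalTail x - halfNormalTail y ∧
    halfNormalTail x - halfNormalTail y ≤ √(2 / Real.pi) * (y - x) * Real.exp (-(x ^ 2 / 2)) := by
  rcases hxy.eq_or_lt with rfl | hlt
  · simp
  obtain ⟨c, ⟨hc1, hc2⟩, hc⟩ := exists_hasDerivAt_eq_slope halfNormalTail _ hlt
    continuous_halfNormalTail.continuousOn fun z _ => hasDerivAt_halfNormalTail z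
  have hpos : 0 < y - x := by linarith
  rw [eq_div_iff hpos.ne'] at hc
  have hd : halfNormalTail x - halfNormalTail y
      = √(2 / Real.pi) * (y - x) * Real.exp (-(c ^ 2 / 2)) := by linarith
  have hs : 0 ≤ √(2 / Real.pi) * (y - x) := by positivity
  rw [hd]
  constructor
  · gcongr
    linarith
  · gcongr

/-- The Mills ratio of the standard Gaussian distribution. -/
lemma tendsto_mills :
    Tendsto (fun x => x * Real.exp (x ^ 2 / 2) * halfNormalTail x) atTop (𝓝 √(2 / Real.pi)) := by
  have key : Tendsto (fun x => halfNormalTail x / (Real.exp (-(x ^ 2 / 2)) / x)) atTop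
      (𝓝 √(2 / Real.pi)) := by
    refine HasDerivAt.lhopital_zero_atTop
      (g' := fun x => (Real.exp (-(x ^ 2 / 2)) * (-x) * x - Real.exp (-(x ^ 2 / 2)) * 1) / x ^ 2)
      (Eventually.of_forall hasDerivAt_halfNormalTail) ?_ ?_ tendsto_halfNormalTail ?_ ?_
    · filter_upwards [eventually_gt_atTop 0] with x hx
      refine HasDerivAt.div (HasDerivAt.exp ?_) (hasDerivAt_id x) hx.ne'
      have := ((hasDerivAt_pow 2 x).div_const 2).neg
      convert! this using 1
      norm_num
    · filter_upwards [eventually_gt_atTop 0] with x hx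
      have h1 : Real.exp (-(x ^ 2 / 2)) * (-x) * x - Real.exp (-(x ^ 2 / 2)) * 1
        = -(Real.exp (-(x ^ 2 / 2)) * (x ^ 2 + 1)) := by ring
      rw [h1]
      have := Real.exp_pos (-(x ^ 2 / 2))
      have : 0 < Real.exp (-(x ^ 2 / 2)) * (x ^ 2 + 1) := by positivity
      exact (div_neg_of_neg_of_pos (by linarith) (by positivity)).ne
    · refine squeeze_zero' ?_ ?_ tendsto_inv_atTop_zero
      · filter_upwards [eventually_gt_atTop 0] with x hx
        positivity
      · filter_upwards [eventually_gt_atTop 0] with x hx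
        rw [div_eq_mul_inv]
        refine mul_le_of_le_one_left (by positivity) (Real.exp_le_one_iff.2 ?_)
        have := sq_nonneg x
        linarith
    · have h0 : Tendsto (fun x : ℝ => √(2 / Real.pi) * (1 + (x⁻¹) ^ 2)⁻¹) atTop
          (𝓝 (√(2 / Real.pi) * (1 + (0 : ℝ) ^ 2)⁻¹)) :=
        (((tendsto_inv_atTop_zero.pow 2).const_add 1).inv₀ (by norm_num)).const_mul _
      simp only [ne_eq, OfNat.ofNat_ne_zero, not_false_eq_true, zero_pow, add_zero, inv_one,
        mul_one] at h0
      refine h0.congr' ?_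
      filter_upwards [eventually_gt_atTop 0] with x hx
      have h1 : Real.exp (-(x ^ 2 / 2)) * (-x) * x - Real.exp (-(x ^ 2 / 2)) * 1
        = -(Real.exp (-(x ^ 2 / 2)) * (x ^ 2 + 1)) := by ring
      have h2 : (1 + (x⁻¹) ^ 2)⁻¹ = x ^ 2 / (x ^ 2 + 1) := by
        field_simp
      rw [mul_one] at h1
      rw [h2, mul_one, h1]
      have := (Real.exp_pos (-(x ^ 2 / 2))).ne'
      field_simp
  refine key.congr' ?_
  filter_upwards [eventually_gt_atTop 0] with x hx
  rw [Real.exp_neg]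
  have := (Real.exp_pos (x ^ 2 / 2)).ne'
  field_simp

/-- Gaussian upper bound for the tail, with the factor of the Mills ratio for large arguments. -/
lemma exists_halfNormalTail_upper : ∃ C : ℝ, 0 < C ∧ ∀ z, 0 ≤ z →
    halfNormalTail z * max 1 z * Real.exp (z ^ 2 / 2) ≤ C := by
  obtain ⟨M, hM⟩ := eventually_atTop.1
    ((tendsto_mills.eventually (gt_mem_nhds (lt_add_one _))))
  set f : ℝ → ℝ := fun z => halfNormalTail z * max 1 z * Real.exp (z ^ 2 / 2)
  have hf : Continuous f := by
    have := continuous_halfNormalTail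
    fun_prop
  obtain ⟨B, hB⟩ := (isCompact_Icc (a := 0) (b := max M 1)).bddAbove_image hf.continuousOn
  refine ⟨max B (√(2 / Real.pi) + 1), lt_max_of_lt_right (by positivity), fun z hz => ?_⟩
  by_cases hzM : z ≤ max M 1
  · exact le_max_of_le_left (hB ⟨z, ⟨hz, hzM⟩, rfl⟩)
  · have h1 : max M 1 < z := not_le.1 hzM
    have h2 := hM z ((le_max_left _ _).trans h1.le)
    have h3 : max 1 z = z := max_eq_right ((le_max_right _ _).trans h1.le)
    refine le_max_of_le_right ?_
    rw [h3]
    linarith [h2]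

/-! ### The half-normal quantile function -/

/-- The inverse of `halfNormalTail` on `[0, ∞)`, extended by `0` to arguments above `1`
(and below `0`, where the infimum of the empty set is `0`). -/
noncomputable def halfNormalQuantile (u : ℝ) : ℝ := sInf {x | 0 ≤ x ∧ halfNormalTail x ≤ u}

lemma halfNormalQuantile_nonneg (u : ℝ) : 0 ≤ halfNormalQuantile u :=
  Real.sInf_nonneg fun _ hx => hx.1

lemma halfNormalQuantile_halfNormalTail {x : ℝ} (hx : 0 ≤ x) :
    halfNormalQuantile (halfNormalTail x) = x := by
  have : {y | 0 ≤ y ∧ halfNormalTail y ≤ halfNormalTail x} = Set.Ici x := by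
    ext y
    simp only [Set.mem_ofPred_eq, Set.mem_Ici, strictAnti_halfNormalTail.le_iff_ge]
    exact ⟨fun h => h.2, fun h => ⟨hx.trans h, h⟩⟩
  rw [halfNormalQuantile, this, csInf_Ici]

lemma halfNormalQuantile_of_one_le {u : ℝ} (hu : 1 ≤ u) : halfNormalQuantile u = 0 := by
  have : {y | 0 ≤ y ∧ halfNormalTail y ≤ u} = Set.Ici 0 := by
    ext y
    simp only [Set.mem_ofPred_eq, Set.mem_Ici]
    exact ⟨fun h => h.1, fun h => ⟨h, (halfNormalTail_le_one h).trans hu⟩⟩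
  rw [halfNormalQuantile, this, csInf_Ici]

lemma exists_halfNormalTail_eq {u : ℝ} (h0 : 0 < u) (h1 : u ≤ 1) :
    ∃ x, 0 ≤ x ∧ halfNormalTail x = u := by
  obtain ⟨M, hM0, hM⟩ := ((eventually_ge_atTop (0 : ℝ)).and
    (tendsto_halfNormalTail.eventually (gt_mem_nhds h0))).exists
  obtain ⟨x, hx, rfl⟩ := intermediate_value_Icc' hM0 continuous_halfNormalTail.continuousOn
    ⟨hM.le, halfNormalTail_zero ▸ h1⟩
  exact ⟨x, hx.1, rfl⟩

lemma halfNormalTail_halfNormalQuantile {u : ℝ} (h0 : 0 < u) :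
    halfNormalTail (halfNormalQuantile u) = min u 1 := by
  rcases le_total u 1 with h1 | h1
  · obtain ⟨x, hx, rfl⟩ := exists_halfNormalTail_eq h0 h1
    rw [halfNormalQuantile_halfNormalTail hx, min_eq_left h1]
  · rw [halfNormalQuantile_of_one_le h1, halfNormalTail_zero, min_eq_right h1]

lemma antitoneOn_halfNormalQuantile : AntitoneOn halfNormalQuantile (Set.Ioi 0) := by
  intro u hu v hv huv
  rw [← strictAnti_halfNormalTail.le_iff_ge, halfNormalTail_halfNormalQuantile hu,
    halfNormalTail_halfNormalQuantile hv]
  exact min_le_min_right 1 huv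

lemma halfNormalQuantile_of_nonpos {u : ℝ} (hu : u ≤ 0) : halfNormalQuantile u = 0 := by
  have : {y | 0 ≤ y ∧ halfNormalTail y ≤ u} = ∅ := by
    ext y
    simp only [Set.mem_ofPred_eq, Set.mem_empty_iff_false, iff_false, not_and, not_le]
    exact fun _ => hu.trans_lt (halfNormalTail_pos y)
  rw [halfNormalQuantile, this, Real.sInf_empty]

@[fun_prop]
lemma measurable_halfNormalQuantile : Measurable halfNormalQuantile := by
  have h1 : Antitone (halfNormalQuantile ∘ Real.exp) := fun x y hxy =>
    antitoneOn_halfNormalQuantile (Real.exp_pos x) (Real.exp_pos y) (Real.exp_le_exp.2 hxy)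
  have h2 : halfNormalQuantile
      = fun u => if 0 < u then (halfNormalQuantile ∘ Real.exp) (Real.log u) else 0 := by
    funext u
    split_ifs with hu
    · simp [Real.exp_log hu]
    · exact halfNormalQuantile_of_nonpos (not_lt.1 hu)
  rw [h2]
  exact Measurable.ite measurableSet_Ioi (h1.measurable.comp Real.measurable_log) measurable_const

/-- `exp(x²/2)` as a function of the tail probability `u = P(|ξ| > x)`. -/
noncomputable def expQuantile (u : ℝ) : ℝ := Real.exp (halfNormalQuantile u ^ 2 / 2)

@[fun_prop]
lemma measurable_expQuantile : Measurable expQuantile := by unfold expQuantile; fun_prop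

lemma expQuantile_pos (u : ℝ) : 0 < expQuantile u := Real.exp_pos _

lemma one_le_expQuantile (u : ℝ) : 1 ≤ expQuantile u :=
  Real.one_le_exp (by positivity)

lemma expQuantile_of_one_le {u : ℝ} (hu : 1 ≤ u) : expQuantile u = 1 := by
  simp [expQuantile, halfNormalQuantile_of_one_le hu]

lemma antitoneOn_expQuantile : AntitoneOn expQuantile (Set.Ioi 0) := by
  intro u hu v hv huv
  have := antitoneOn_halfNormalQuantile hu hv huv
  have := halfNormalQuantile_nonneg v
  unfold expQuantile
  gcongr

/-- Comparison of increments, obtained by comparing the derivatives `t exp(t²/2)` and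
`exp(-t²/2)`, whose ratio `t exp(t²)` is increasing. -/
lemma exp_sq_sub_le {x y : ℝ} (hx : 0 ≤ x) (hxy : x ≤ y) :
    √(2 / Real.pi) * (Real.exp (y ^ 2 / 2) - Real.exp (x ^ 2 / 2))
      ≤ y * Real.exp (y ^ 2) * (halfNormalTail x - halfNormalTail y) := by
  set F : ℝ → ℝ := fun t => √(2 / Real.pi) * Real.exp (t ^ 2 / 2)
    + y * Real.exp (y ^ 2) * halfNormalTail t
  have hF : ∀ t, HasDerivAt F (√(2 / Real.pi) * (Real.exp (t ^ 2 / 2) * t)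
      + y * Real.exp (y ^ 2) * (-(√(2 / Real.pi) * Real.exp (-(t ^ 2 / 2))))) t := fun t => by
    have h1 : HasDerivAt (fun t : ℝ => t ^ 2 / 2) t t := by
      have := (hasDerivAt_pow 2 t).div_const 2
      convert! this using 1
      norm_num
    exact (h1.exp.const_mul _).add ((hasDerivAt_halfNormalTail t).const_mul _)
  have hanti : AntitoneOn F (Set.Icc 0 y) := by
    refine antitoneOn_of_deriv_nonpos (convex_Icc 0 y)
      (fun t _ => (hF t).continuousAt.continuousWithinAt)
      (fun t _ => (hF t).differentiableAt.differentiableWithinAt) fun t ht => ?_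
    rw [interior_Icc] at ht
    rw [(hF t).deriv]
    have h2 : t * Real.exp (t ^ 2 / 2) ≤ y * Real.exp (y ^ 2) * Real.exp (-(t ^ 2 / 2)) := by
      have : Real.exp (t ^ 2 / 2) = Real.exp (t ^ 2) * Real.exp (-(t ^ 2 / 2)) := by
        rw [← Real.exp_add]; ring_nf
      rw [this, ← mul_assoc]
      have := ht.1.le
      have := ht.2.le
      have : 0 ≤ y := hx.trans hxy
      gcongr
    have h3 : 0 ≤ √(2 / Real.pi) := by positivity
    nlinarith
  have := hanti ⟨hx, hxy⟩ ⟨hx.trans hxy, le_rfl⟩ hxy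
  simp only [F] at this
  linarith

/-- A Lipschitz bound for `expQuantile` on `[m, ∞)`. The factor `1 / max 1 (q m)` improves the
bound `1 / m²` by the slowly varying factor `√(log (1/m))`. -/
lemma exists_abs_expQuantile_sub_le : ∃ C : ℝ, 0 < C ∧ ∀ m u v : ℝ, 0 < m → m ≤ u → m ≤ v →
    |expQuantile u - expQuantile v| ≤ C * |u - v| / (m ^ 2 * max 1 (halfNormalQuantile m)) := by
  obtain ⟨C, hC, hb⟩ := exists_halfNormalTail_upper
  have hs : 0 < √(2 / Real.pi) := by positivity
  refine ⟨C ^ 2 / √(2 / Real.pi), by positivity, fun m u v hm hu hv => ?_⟩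
  wlog huv : u ≤ v generalizing u v
  · rw [abs_sub_comm, abs_sub_comm u]
    exact this v u hv hu (le_of_not_ge huv)
  have hu0 := hm.trans_le hu
  have hv0 := hm.trans_le hv
  have hyx := antitoneOn_halfNormalQuantile hu0 hv0 huv
  have hzy := antitoneOn_halfNormalQuantile hm hu0 hu
  have hx := halfNormalQuantile_nonneg v
  rw [abs_of_nonneg (sub_nonneg.2 (antitoneOn_expQuantile hu0 hv0 huv)), abs_sub_comm,
    abs_of_nonneg (sub_nonneg.2 huv)]
  have h1 := exp_sq_sub_le hx hyx
  rw [halfNormalTail_halfNormalQuantile hu0, halfNormalTail_halfNormalQuantile hv0] at h1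
  have h2 : min v 1 - min u 1 ≤ v - u := by
    rcases le_total v 1 with h | h <;> rcases le_total u 1 with h' | h' <;> simp [h, h'] <;>
      linarith
  have h20 : 0 ≤ min v 1 - min u 1 := sub_nonneg.2 (min_le_min_right 1 huv)
  set y := halfNormalQuantile u
  set z := halfNormalQuantile m with hz
  have hy0 : 0 ≤ y := hx.trans hyx
  have hz0 : 0 ≤ z := hy0.trans hzy
  have h3 : y * Real.exp (y ^ 2) ≤ C ^ 2 / (m ^ 2 * max 1 z) := by
    refine (by gcongr : y * Real.exp (y ^ 2) ≤ z * Real.exp (z ^ 2)).trans ?_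
    rw [le_div_iff₀ (by positivity)]
    rcases le_total m 1 with hm1 | hm1
    · have h4 := hb z hz0
      have h5 : halfNormalTail z = m := by
        rw [hz, halfNormalTail_halfNormalQuantile hm, min_eq_left hm1]
      rw [h5] at h4
      calc z * Real.exp (z ^ 2) * (m ^ 2 * max 1 z)
          ≤ max 1 z * Real.exp (z ^ 2) * (m ^ 2 * max 1 z) := by
            gcongr; exact le_max_right _ _
        _ = (m * max 1 z * Real.exp (z ^ 2 / 2)) ^ 2 := by
            have : Real.exp (z ^ 2) = Real.exp (z ^ 2 / 2) ^ 2 := by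
              rw [← Real.exp_nat_mul]; ring_nf
            rw [this]; ring
        _ ≤ C ^ 2 := by gcongr
    · rw [hz, halfNormalQuantile_of_one_le hm1]
      simp
      positivity
  have h6 : √(2 / Real.pi) * (expQuantile u - expQuantile v)
      ≤ C ^ 2 / (m ^ 2 * max 1 z) * (v - u) := by
    refine h1.trans ?_
    gcongr
  calc expQuantile u - expQuantile v
      = (√(2 / Real.pi) * (expQuantile u - expQuantile v)) / √(2 / Real.pi) := by
        field_simp
    _ ≤ (C ^ 2 / (m ^ 2 * max 1 z) * (v - u)) / √(2 / Real.pi) := by gcongr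
    _ = _ := by ring

/-- A primitive of `-expQuantile` on `(0, ∞)`. Below `1` it is `√(2/π)` times the quantile, because
`∫ exp(x²/2) dP(|ξ| ≤ x) = √(2/π) ∫ dx`. -/
noncomputable def quantilePrimitive (u : ℝ) : ℝ :=
  √(2 / Real.pi) * halfNormalQuantile u - max (u - 1) 0

/-- The increment of `quantilePrimitive` lies between the lower and the upper rectangle of the
antitone function `expQuantile`. -/
lemma quantilePrimitive_sub_bounds {a b : ℝ} (ha : 0 < a) (hab : a ≤ b) :
    (b - a) * expQuantile b ≤ quantilePrimitive a - quantilePrimitive b ∧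
    quantilePrimitive a - quantilePrimitive b ≤ (b - a) * expQuantile a := by
  have hb := ha.trans_le hab
  have hyx := antitoneOn_halfNormalQuantile ha hb hab
  obtain ⟨h1, h2⟩ := halfNormalTail_sub_bounds (halfNormalQuantile_nonneg b) hyx
  rw [halfNormalTail_halfNormalQuantile ha, halfNormalTail_halfNormalQuantile hb, Real.exp_neg,
    ← div_eq_mul_inv] at h1 h2
  rw [div_le_iff₀ (Real.exp_pos _)] at h1
  rw [le_div_iff₀ (Real.exp_pos _)] at h2
  change _ ≤ (min b 1 - min a 1) * expQuantile a at h1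
  change (min b 1 - min a 1) * expQuantile b ≤ _ at h2
  have hd : b - a = (min b 1 - min a 1) + (max (b - 1) 0 - max (a - 1) 0) := by
    rcases le_total b 1 with h | h <;> rcases le_total a 1 with h' | h' <;> simp [h, h']
  have hd2 : 0 ≤ max (b - 1) 0 - max (a - 1) 0 :=
    sub_nonneg.2 (max_le_max_right 0 (by linarith))
  have h3 := mul_le_mul_of_nonneg_left (one_le_expQuantile a) hd2
  have h4 : (max (b - 1) 0 - max (a - 1) 0) * expQuantile b = max (b - 1) 0 - max (a - 1) 0 := by
    rcases le_total b 1 with h | h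
    · have h' := hab.trans h
      simp [h, h']
    · rw [expQuantile_of_one_le h, mul_one]
  unfold quantilePrimitive
  rw [hd, add_mul, add_mul, h4]
  constructor <;> linarith

lemma quantilePrimitive_one : quantilePrimitive 1 = 0 := by
  simp [quantilePrimitive, halfNormalQuantile_of_one_le le_rfl]

/-- The quantile grows at least like `√(log (1/u))`. -/
lemma exists_neg_log_le : ∃ C : ℝ, 0 < C ∧ ∀ u, 0 < u →
    -Real.log u ≤ C * max 1 (halfNormalQuantile u) ^ 2 := by
  set s := √(2 / Real.pi)
  have hs : 0 < s := by positivity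
  refine ⟨2 + |Real.log s|, by positivity, fun u hu => ?_⟩
  have hm : 1 ≤ max 1 (halfNormalQuantile u) ^ 2 := one_le_pow₀ (le_max_left _ _)
  rcases le_total u 1 with h1 | h1
  · obtain ⟨x, hx, rfl⟩ := exists_halfNormalTail_eq hu h1
    rw [halfNormalQuantile_halfNormalTail hx] at hm ⊢
    have h2 := (halfNormalTail_sub_bounds hx (by linarith : x ≤ x + 1)).1
    have h3 := halfNormalTail_pos (x + 1)
    have h4 : s * Real.exp (-((x + 1) ^ 2 / 2)) ≤ halfNormalTail x := by
      have : s * (x + 1 - x) * Real.exp (-((x + 1) ^ 2 / 2))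
        = s * Real.exp (-((x + 1) ^ 2 / 2)) := by ring
      linarith
    have h5 := Real.log_le_log (by positivity) h4
    rw [Real.log_mul hs.ne' (Real.exp_pos _).ne', Real.log_exp] at h5
    have h6 : (x + 1) ^ 2 / 2 ≤ 2 * max 1 x ^ 2 := by
      have : x + 1 ≤ 2 * max 1 x := by
        have := le_max_left 1 x; have := le_max_right 1 x; linarith
      nlinarith
    have h7 : |Real.log s| ≤ |Real.log s| * max 1 x ^ 2 :=
      le_mul_of_one_le_right (abs_nonneg _) hm
    have := neg_abs_le (Real.log s)
    linarith
  · have := Real.log_nonneg h1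
    have : 0 ≤ (2 + |Real.log s|) * max 1 (halfNormalQuantile u) ^ 2 := by positivity
    linarith

lemma tendsto_halfNormalQuantile : Tendsto halfNormalQuantile (𝓝[>] 0) atTop := by
  refine tendsto_atTop.2 fun M => ?_
  have h := halfNormalTail_pos (max M 0)
  filter_upwards [Ioo_mem_nhdsGT h] with u hu
  refine (le_max_left M 0).trans ?_
  rw [← halfNormalQuantile_halfNormalTail (le_max_right M 0)]
  exact antitoneOn_halfNormalQuantile hu.1 h hu.2.le

lemma tendsto_mul_quantile_mul_expQuantile :
    Tendsto (fun u => u * halfNormalQuantile u * expQuantile u) (𝓝[>] 0) (𝓝 √(2 / Real.pi)) := by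
  refine (tendsto_mills.comp tendsto_halfNormalQuantile).congr' ?_
  filter_upwards [Ioo_mem_nhdsGT one_pos] with u hu
  simp only [Function.comp_apply, halfNormalTail_halfNormalQuantile hu.1, min_eq_left hu.2.le,
    expQuantile]
  ring

lemma tendsto_neg_log_div_quantile_sq :
    Tendsto (fun u => -Real.log u / (halfNormalQuantile u ^ 2 / 2)) (𝓝[>] 0) (𝓝 1) := by
  have hs : 0 < √(2 / Real.pi) := by positivity
  have h1 := (Real.continuousAt_log hs.ne').tendsto.comp tendsto_mul_quantile_mul_expQuantile
  have hq := tendsto_halfNormalQuantile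
  have hq2 : Tendsto (fun u => halfNormalQuantile u ^ 2 / 2) (𝓝[>] 0) atTop :=
    ((tendsto_pow_atTop two_ne_zero).comp hq).atTop_div_const two_pos
  have h2 := h1.div_atTop hq2
  have h3 : Tendsto (fun u => Real.log (halfNormalQuantile u) / (halfNormalQuantile u ^ 2 / 2))
      (𝓝[>] 0) (𝓝 0) := by
    have := (Real.isLittleO_log_id_atTop.tendsto_div_nhds_zero.mul tendsto_inv_atTop_zero).comp hq
    have := this.const_mul 2
    simp only [mul_zero] at this
    refine this.congr' ?_
    filter_upwards [hq.eventually_gt_atTop 0] with u hu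
    simp only [Function.comp_apply, id]
    field_simp
  have h4 := (h3.sub h2).const_add 1
  simp only [sub_zero, add_zero] at h4
  refine h4.congr' ?_
  filter_upwards [hq.eventually_gt_atTop 0, self_mem_nhdsWithin] with u hu hu0
  have hu0 : 0 < u := hu0
  simp only [Function.comp_apply]
  rw [Real.log_mul (by positivity) (expQuantile_pos u).ne', Real.log_mul hu0.ne' hu.ne',
    expQuantile, Real.log_exp]
  field_simp
  ring

/-- The asymptotics `expQuantile u ~ 1 / (u √(π log (1/u)))` as `u → 0`. -/
lemma tendsto_mul_expQuantile_mul_sqrt_log :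
    Tendsto (fun u => u * expQuantile u * √(Real.pi * -Real.log u)) (𝓝[>] 0) (𝓝 1) := by
  have hq := tendsto_halfNormalQuantile
  have h := tendsto_mul_quantile_mul_expQuantile.mul
    ((tendsto_neg_log_div_quantile_sq.const_mul (Real.pi / 2)).sqrt)
  have e : √(2 / Real.pi) * √(Real.pi / 2 * 1) = 1 := by
    rw [← Real.sqrt_mul (by positivity), mul_one, div_mul_div_cancel₀ (by positivity),
      div_self two_ne_zero, Real.sqrt_one]
  rw [e] at h
  refine h.congr' ?_
  filter_upwards [hq.eventually_gt_atTop 0] with u hu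
  have : Real.pi / 2 * (-Real.log u / (halfNormalQuantile u ^ 2 / 2))
      = (Real.pi * -Real.log u) / halfNormalQuantile u ^ 2 := by field_simp
  rw [this, Real.sqrt_div' _ (by positivity), Real.sqrt_sq hu.le]
  field_simp

/-! ### Asymptotics of the quantile functions at small arguments -/

lemma tendsto_div_atTop_nhdsGT_zero {s : ℝ} (hs : 0 < s) :
    Tendsto (fun N : ℝ => s / N) atTop (𝓝[>] 0) :=
  tendsto_nhdsWithin_iff.2 ⟨tendsto_id.const_div_atTop s,
    (eventually_gt_atTop 0).mono fun _ h => div_pos hs h⟩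

lemma tendsto_log_div_log_div {s : ℝ} (hs : 0 < s) :
    Tendsto (fun N : ℝ => Real.log N / -Real.log (s / N)) atTop (𝓝 1) := by
  have h := ((tendsto_const_nhds (x := Real.log s)).div_atTop Real.tendsto_log_atTop).const_sub 1
  have h2 := h.inv₀ (by norm_num)
  simp only [sub_zero, inv_one] at h2
  refine h2.congr' ?_
  filter_upwards [eventually_gt_atTop 1] with N hN
  have := Real.log_pos hN
  rw [Real.log_div hs.ne' (by positivity), neg_sub, ← inv_div]
  field_simp

lemma tendsto_expQuantile_div {s : ℝ} (hs : 0 < s) :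
    Tendsto (fun N : ℝ => √(Real.pi * Real.log N) / N * expQuantile (s / N)) atTop (𝓝 (1 / s)) := by
  have h1 := tendsto_mul_expQuantile_mul_sqrt_log.comp (tendsto_div_atTop_nhdsGT_zero hs)
  have h2 := ((h1.mul (tendsto_log_div_log_div hs).sqrt)).div_const s
  simp only [Real.sqrt_one, mul_one] at h2
  refine h2.congr' ?_
  filter_upwards [eventually_gt_atTop 0, eventually_gt_atTop s] with N hN hNs
  have hl : 0 < -Real.log (s / N) :=
    neg_pos.2 (Real.log_neg (by positivity) ((div_lt_one hN).2 hNs))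
  have hl' : Real.log (s / N) ≠ 0 := (neg_pos.1 hl).ne
  simp only [Function.comp_apply]
  rw [mul_assoc, ← Real.sqrt_mul (by positivity)]
  have : Real.pi * -Real.log (s / N) * (Real.log N / -Real.log (s / N)) = Real.pi * Real.log N := by
    field_simp
  rw [this]
  field_simp

lemma tendsto_halfNormalQuantile_div_sqrt_log {s : ℝ} (hs : 0 < s) :
    Tendsto (fun N : ℝ => halfNormalQuantile (s / N) / √(Real.log N)) atTop (𝓝 √2) := by
  have h1 := (tendsto_neg_log_div_quantile_sq.comp (tendsto_div_atTop_nhdsGT_zero hs)).mul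
    (tendsto_log_div_log_div hs)
  have h2 := ((h1.inv₀ (by norm_num)).const_mul 2).sqrt
  simp only [mul_one, inv_one] at h2
  refine h2.congr' ?_
  filter_upwards [eventually_gt_atTop 0, eventually_gt_atTop s, eventually_gt_atTop 1]
    with N hN hNs hN1
  have hl : 0 < -Real.log (s / N) :=
    neg_pos.2 (Real.log_neg (by positivity) ((div_lt_one hN).2 hNs))
  have hl' : Real.log (s / N) ≠ 0 := (neg_pos.1 hl).ne
  have hL := Real.log_pos hN1
  simp only [Function.comp_apply]
  have : 2 * (-Real.log (s / N) / (halfNormalQuantile (s / N) ^ 2 / 2) *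
      (Real.log N / -Real.log (s / N)))⁻¹ = halfNormalQuantile (s / N) ^ 2 / Real.log N := by
    by_cases hq : halfNormalQuantile (s / N) = 0
    · simp [hq]
    · field_simp
  rw [this, Real.sqrt_div' _ hL.le, Real.sqrt_sq (halfNormalQuantile_nonneg _)]

/-- The scaled integral of `expQuantile` over `[a/N, b/N]` tends to `∫_a^b dx/x`. -/
lemma tendsto_quantilePrimitive_sub {a b : ℝ} (ha : 0 < a) (hb : 0 < b) :
    Tendsto (fun N : ℝ => √(Real.pi * Real.log N) *
      (quantilePrimitive (a / N) - quantilePrimitive (b / N))) atTop (𝓝 (Real.log (b / a))) := by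
  -- `(q(a/N)² - q(b/N)²) / 2` is the logarithm of a ratio of two values of `expQuantile`
  have h1 : Tendsto (fun N : ℝ => Real.log (expQuantile (a / N)) - Real.log (expQuantile (b / N)))
      atTop (𝓝 (Real.log (b / a))) := by
    have h := (tendsto_expQuantile_div ha).div (tendsto_expQuantile_div hb) (by positivity)
    have e : 1 / a / (1 / b) = b / a := by field_simp
    rw [e] at h
    refine (((Real.continuousAt_log (by positivity)).tendsto.comp h)).congr' ?_
    filter_upwards [eventually_gt_atTop 1] with N hN
    have hL := Real.log_pos hN
    have hs : 0 < √(Real.pi * Real.log N) := by positivity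
    simp only [Function.comp_apply, Pi.div_apply]
    rw [mul_div_mul_left _ _ (by positivity),
      Real.log_div (expQuantile_pos _).ne' (expQuantile_pos _).ne']
  have hqa := tendsto_halfNormalQuantile_div_sqrt_log ha
  have hqb := tendsto_halfNormalQuantile_div_sqrt_log hb
  have h2 := (h1.mul ((hqa.add hqb).inv₀ (by positivity))).const_mul (2 * √2)
  have e : 2 * √2 * (Real.log (b / a) * (√2 + √2)⁻¹) = Real.log (b / a) := by
    field_simp
    ring
  rw [e] at h2
  refine h2.congr' ?_
  filter_upwards [eventually_gt_atTop 1, eventually_ge_atTop a, eventually_ge_atTop b,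
    (tendsto_halfNormalQuantile.comp (tendsto_div_atTop_nhdsGT_zero ha)).eventually_gt_atTop 0]
    with N hN hNa hNb hqa
  have hN0 : 0 < N := by linarith
  have hL := Real.log_pos hN
  have hA : a / N ≤ 1 := (div_le_one hN0).2 hNa
  have hB : b / N ≤ 1 := (div_le_one hN0).2 hNb
  simp only [Function.comp_apply] at hqa
  have hqb := halfNormalQuantile_nonneg (b / N)
  simp only [expQuantile, Real.log_exp, quantilePrimitive]
  rw [max_eq_right (by linarith), max_eq_right (by linarith), sub_zero, sub_zero, ← mul_sub,
    ← add_div, inv_div, ← mul_assoc √_, ← Real.sqrt_mul (by positivity)]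
  have e2 : Real.pi * Real.log N * (2 / Real.pi) = 2 * Real.log N := by field_simp
  rw [e2, Real.sqrt_mul (by norm_num)]
  field_simp
  ring

/-- The summable majorant for the series in `k` comparing `expQuantile` at the points `Γ_k / N`
with its integral over `[k / N, (k + 1) / N]`, uniformly in `N`. -/
lemma exists_expQuantile_sub_majorant : ∃ C : ℝ, 0 < C ∧ ∀ (N c s : ℝ) (k : ℕ), 1 ≤ N → 0 < c →
    c ≤ 1 → c * (k + 1) ≤ s →
    √(Real.pi * Real.log N) / N * |expQuantile (s / N) -
      N * (quantilePrimitive ((k + 1) / N) - quantilePrimitive ((k + 2) / N))|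
      ≤ C / c ^ 2 * ((|s - (k + 1)| + 1) * ((k : ℝ) + 1) ^ (-(7 / 4) : ℝ)) := by
  obtain ⟨C₁, hC₁, hlip⟩ := exists_abs_expQuantile_sub_le
  obtain ⟨C₂, hC₂, hlog⟩ := exists_neg_log_le
  refine ⟨√(Real.pi * (C₂ + 2)) * C₁, by positivity, fun N c s k hN hc hc1 hs => ?_⟩
  have hN0 : 0 < N := by linarith
  have hk : (0 : ℝ) < k + 1 := by positivity
  have hk1 : (1 : ℝ) ≤ k + 1 := by linarith [(Nat.cast_nonneg k : (0 : ℝ) ≤ k)]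
  set m : ℝ := c * (k + 1) / N with hm
  have hm0 : 0 < m := by positivity
  set M := max 1 (halfNormalQuantile m) with hM
  have hM1 : 1 ≤ M := le_max_left _ _
  set D := |s - (k + 1)| + 1 with hD
  have hD0 : 0 < D := by positivity
  have hck : c * (k + 1) ≤ k + 1 := mul_le_of_le_one_left hk.le hc1
  have hl : ∀ v : ℝ, k + 1 ≤ v → v ≤ k + 2 →
      |expQuantile (s / N) - expQuantile (v / N)| ≤ C₁ * (D / N) / (m ^ 2 * M) := by
    intro v hv1 hv2
    refine (hlip m (s / N) (v / N) hm0 (by rw [hm]; gcongr)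
      (by rw [hm]; gcongr; exact hck.trans hv1)).trans ?_
    have : |s / N - v / N| ≤ D / N := by
      rw [← sub_div, abs_div, abs_of_pos hN0]
      gcongr
      rw [hD]
      calc |s - v| = |(s - (k + 1)) + ((k + 1) - v)| := by ring_nf
        _ ≤ |s - (k + 1)| + |(k + 1) - v| := abs_add_le _ _
        _ ≤ _ := by
          gcongr
          rw [abs_le]
          constructor <;> linarith
    gcongr
  have hJ := quantilePrimitive_sub_bounds (a := (k + 1) / N) (b := (k + 2) / N) (by positivity)
    (by gcongr; linarith)
  have hba : (k + 2) / N - (k + 1) / N = 1 / N := by ring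
  rw [hba] at hJ
  have hJ1 : expQuantile ((k + 2) / N) ≤
      N * (quantilePrimitive ((k + 1) / N) - quantilePrimitive ((k + 2) / N)) := by
    have := mul_le_mul_of_nonneg_left hJ.1 hN0.le
    rwa [← mul_assoc, mul_one_div_cancel hN0.ne', one_mul] at this
  have hJ2 : N * (quantilePrimitive ((k + 1) / N) - quantilePrimitive ((k + 2) / N)) ≤
      expQuantile ((k + 1) / N) := by
    have := mul_le_mul_of_nonneg_left hJ.2 hN0.le
    rwa [← mul_assoc, mul_one_div_cancel hN0.ne', one_mul] at this
  have hmain : |expQuantile (s / N) -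
      N * (quantilePrimitive ((k + 1) / N) - quantilePrimitive ((k + 2) / N))|
      ≤ C₁ * (D / N) / (m ^ 2 * M) := by
    have h1 := abs_le.1 (hl (k + 1) le_rfl (by linarith))
    have h2 := abs_le.1 (hl (k + 2) (by linarith) le_rfl)
    rw [abs_le]
    constructor <;> linarith [h1.1, h2.2]
  have hsq : √(Real.pi * Real.log N) ≤
      √(Real.pi * (C₂ + 2)) * (((k : ℝ) + 1) ^ (1 / 4 : ℝ) * M) := by
    have h1 : Real.log N = -Real.log m + Real.log (c * (k + 1)) := by
      rw [hm, Real.log_div (by positivity) hN0.ne']; ring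
    have h2 : Real.log (c * (k + 1)) ≤ 2 * ((k : ℝ) + 1) ^ (1 / 2 : ℝ) := by
      refine (Real.log_le_log (by positivity) hck).trans ?_
      refine (Real.log_le_rpow_div hk.le (by norm_num : (0 : ℝ) < 1 / 2)).trans (le_of_eq ?_)
      ring
    have h3 : (1 : ℝ) ≤ ((k : ℝ) + 1) ^ (1 / 2 : ℝ) := Real.one_le_rpow hk1 (by norm_num)
    have h4 : Real.log N ≤ (C₂ + 2) * (((k : ℝ) + 1) ^ (1 / 2 : ℝ) * M ^ 2) := by
      have h5 := hlog m hm0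
      have h6 : C₂ * M ^ 2 ≤ C₂ * (((k : ℝ) + 1) ^ (1 / 2 : ℝ) * M ^ 2) := by
        gcongr
        exact le_mul_of_one_le_left (by positivity) h3
      have h7 : ((k : ℝ) + 1) ^ (1 / 2 : ℝ) ≤ ((k : ℝ) + 1) ^ (1 / 2 : ℝ) * M ^ 2 :=
        le_mul_of_one_le_right (by positivity) (one_le_pow₀ hM1)
      rw [h1]
      linarith
    have h8 : ((k : ℝ) + 1) ^ (1 / 2 : ℝ) = (((k : ℝ) + 1) ^ (1 / 4 : ℝ)) ^ 2 := by
      rw [← Real.rpow_natCast, ← Real.rpow_mul hk.le]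
      norm_num
    rw [h8, ← mul_pow] at h4
    calc √(Real.pi * Real.log N)
        ≤ √(Real.pi * (C₂ + 2) * (((k : ℝ) + 1) ^ (1 / 4 : ℝ) * M) ^ 2) := by
          refine Real.sqrt_le_sqrt ?_
          rw [mul_assoc]
          gcongr
      _ = _ := by
          rw [Real.sqrt_mul (by positivity), Real.sqrt_sq (by positivity)]
  have hpow : ((k : ℝ) + 1) ^ (-(7 / 4) : ℝ) = ((k : ℝ) + 1) ^ (1 / 4 : ℝ) / ((k : ℝ) + 1) ^ 2 := by
    rw [← Real.rpow_natCast, ← Real.rpow_sub hk]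
    norm_num
  calc _ ≤ √(Real.pi * (C₂ + 2)) * (((k : ℝ) + 1) ^ (1 / 4 : ℝ) * M) / N *
        (C₁ * (D / N) / (m ^ 2 * M)) := by gcongr
    _ = _ := by
        rw [hpow, hm]
        field_simp

/-- The series `∑_{k ≥ 1} (1/k - log((k+1)/k)) = γ`, with `k` shifted by one. -/
lemma hasSum_eulerMascheroni :
    HasSum (fun k : ℕ => 1 / ((k : ℝ) + 1) - Real.log (((k : ℝ) + 2) / (k + 1)))
      Real.eulerMascheroniConstant := by
  rw [hasSum_iff_tendsto_nat_of_nonneg]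
  · refine Real.tendsto_eulerMascheroniSeq.congr fun n => ?_
    induction n with
    | zero => simp [Real.eulerMascheroniSeq]
    | succ n ih =>
      rw [Finset.sum_range_succ, ← ih, Real.eulerMascheroniSeq, Real.eulerMascheroniSeq,
        harmonic_succ, Real.log_div (by positivity) (by positivity)]
      push_cast
      rw [show (n : ℝ) + 1 + 1 = n + 2 by ring]
      ring
  · intro k
    have h := Real.log_le_sub_one_of_pos (by positivity : 0 < ((k : ℝ) + 2) / (k + 1))
    have : ((k : ℝ) + 2) / (k + 1) - 1 = 1 / (k + 1) := by field_simp; ring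
    linarith

/-! ### The centring sequence -/

section Centring

variable {l : Filter ℕ} {N : ℕ → ℝ}

lemma tendsto_log_mul_div_sub_one (hl : l ≤ atTop)
    (hN : Tendsto (fun n : ℕ => Real.log n * (|N n - (n + 1)| / n)) l (𝓝 0)) :
    Tendsto (fun n : ℕ => Real.log n * (N n / n - 1)) l (𝓝 0) := by
  have h1 : Tendsto (fun n : ℕ => Real.log n / n) l (𝓝 0) :=
    ((Real.isLittleO_log_id_atTop.tendsto_div_nhds_zero.comp
      tendsto_natCast_atTop_atTop).mono_left hl)
  have h2 := hN.add h1
  rw [add_zero] at h2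
  refine squeeze_zero_norm' ?_ h2
  filter_upwards [hl (eventually_ge_atTop 1)] with n hn
  have hn1 : (1 : ℝ) ≤ n := by exact_mod_cast hn
  have hL := Real.log_nonneg hn1
  have hn0 : (0 : ℝ) < n := by linarith
  rw [Real.norm_eq_abs, abs_mul, abs_of_nonneg hL, div_sub_one hn0.ne', abs_div, abs_of_pos hn0,
    mul_div_assoc', mul_div_assoc', ← add_div, ← mul_add_one]
  gcongr
  calc |N n - n| = |(N n - (n + 1)) + 1| := by ring_nf
    _ ≤ _ := (abs_add_le _ _).trans (by simp)

lemma tendsto_div_natCast (hl : l ≤ atTop)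
    (hN : Tendsto (fun n : ℕ => Real.log n * (|N n - (n + 1)| / n)) l (𝓝 0)) :
    Tendsto (fun n : ℕ => N n / n) l (𝓝 1) := by
  have hlog : Tendsto (fun n : ℕ => Real.log n) l atTop :=
    (Real.tendsto_log_atTop.comp tendsto_natCast_atTop_atTop).mono_left hl
  have h := ((tendsto_log_mul_div_sub_one hl hN).mul hlog.inv_tendsto_atTop).add_const 1
  simp only [mul_zero, zero_add] at h
  refine h.congr' ?_
  filter_upwards [hlog.eventually_gt_atTop 0] with n hn
  simp only [Pi.inv_apply]
  field_simp
  ring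

lemma tendsto_atTop_of_div_natCast (hl : l ≤ atTop)
    (hr : Tendsto (fun n : ℕ => N n / n) l (𝓝 1)) : Tendsto N l atTop := by
  refine (hr.pos_mul_atTop one_pos (tendsto_natCast_atTop_atTop.mono_left hl)).congr' ?_
  filter_upwards [hl (eventually_ge_atTop 1)] with n hn
  have : (n : ℝ) ≠ 0 := by positivity
  field_simp

lemma tendsto_log_div_log (hl : l ≤ atTop) (hr : Tendsto (fun n : ℕ => N n / n) l (𝓝 1)) :
    Tendsto (fun n : ℕ => Real.log (N n) / Real.log n) l (𝓝 1) := by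
  have hlog : Tendsto (fun n : ℕ => Real.log n) l atTop :=
    (Real.tendsto_log_atTop.comp tendsto_natCast_atTop_atTop).mono_left hl
  have h := (((Real.continuousAt_log one_ne_zero).tendsto.comp hr).div_atTop hlog).add_const 1
  rw [zero_add] at h
  refine h.congr' ?_
  filter_upwards [hlog.eventually_gt_atTop 0, hl (eventually_ge_atTop 1),
    (tendsto_atTop_of_div_natCast hl hr).eventually_gt_atTop 0] with n hL hn hN
  have : (n : ℝ) ≠ 0 := by positivity
  simp only [Function.comp_apply]
  rw [Real.log_div hN.ne' this]
  field_simp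
  ring

/-- For large `n` the argument of the square root defining `b_n` is positive. -/
lemma eventually_bSeq_sq : ∀ᶠ n : ℕ in atTop, bSeq n ^ 2 / 2 =
    Real.log n - Real.log (Real.pi * Real.log n) / 2 ∧ 0 ≤ bSeq n := by
  have hlog : Tendsto (fun n : ℕ => Real.log n) atTop atTop :=
    Real.tendsto_log_atTop.comp tendsto_natCast_atTop_atTop
  have h := (Real.isLittleO_log_id_atTop.tendsto_div_nhds_zero.comp
    (hlog.const_mul_atTop Real.pi_pos))
  have h2 := h.eventually (gt_mem_nhds (by positivity : 0 < 1 / Real.pi))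
  filter_upwards [h2, hlog.eventually_gt_atTop 0, eventually_ge_atTop 1] with n hn hL hn1
  simp only [Function.comp_apply, id] at hn
  have hn0 : (n : ℝ) ≠ 0 := by positivity
  have hp := Real.pi_pos
  rw [div_lt_div_iff₀ (by positivity) hp] at hn
  have e : Real.log ((n : ℝ) / √(Real.pi * Real.log n)) =
      Real.log n - Real.log (Real.pi * Real.log n) / 2 := by
    rw [Real.log_div hn0 (by positivity), Real.log_sqrt (by positivity)]
  refine ⟨?_, Real.sqrt_nonneg _⟩
  rw [bSeq, Real.sq_sqrt, e]
  · ring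
  · rw [e]
    have : Real.log (Real.pi * Real.log n) < Real.log n := by nlinarith
    linarith

lemma tendsto_bSeq_div : Tendsto (fun n : ℕ => bSeq n / √(Real.log n)) atTop (𝓝 √2) := by
  have hlog : Tendsto (fun n : ℕ => Real.log n) atTop atTop :=
    Real.tendsto_log_atTop.comp tendsto_natCast_atTop_atTop
  have h := ((Real.isLittleO_log_id_atTop.tendsto_div_nhds_zero.comp
    (hlog.const_mul_atTop Real.pi_pos)).const_mul Real.pi).const_sub 2
  rw [mul_zero, sub_zero] at h
  refine h.sqrt.congr' ?_
  filter_upwards [hlog.eventually_gt_atTop 0, eventually_bSeq_sq] with n hL hb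
  simp only [Function.comp_apply, id]
  rw [← Real.sqrt_sq hb.2, ← Real.sqrt_div' _ hL.le]
  congr 1
  have : bSeq n ^ 2 = 2 * Real.log n - Real.log (Real.pi * Real.log n) := by linarith [hb.1]
  rw [this]
  have := Real.pi_pos
  field_simp

/-- The half-normal quantile at `1/N` is `b_n` up to `o(1/√(log n))`, if `N ~ n`. -/
lemma tendsto_quantile_sub_bSeq (hl : l ≤ atTop) (hr : Tendsto (fun n : ℕ => N n / n) l (𝓝 1)) :
    Tendsto (fun n : ℕ => √(Real.log n) * (halfNormalQuantile (1 / N n) - bSeq n)) l (𝓝 0) := by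
  have hlog : Tendsto (fun n : ℕ => Real.log n) l atTop :=
    (Real.tendsto_log_atTop.comp tendsto_natCast_atTop_atTop).mono_left hl
  have hN := tendsto_atTop_of_div_natCast hl hr
  have hll := tendsto_log_div_log hl hr
  have h1 := (Real.continuousAt_log (by norm_num : (1 : ℝ) / 1 ≠ 0)).tendsto.comp
    ((tendsto_expQuantile_div one_pos).comp hN)
  have h2 := (Real.continuousAt_log one_ne_zero).tendsto.comp hr
  have h3 := ((Real.continuousAt_log one_ne_zero).tendsto.comp hll).div_const 2
  have hsq := (h1.add h2).sub h3
  simp only [div_one, Real.log_one, add_zero, zero_div, sub_zero] at hsq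
  have hq := ((tendsto_halfNormalQuantile_div_sqrt_log one_pos).comp hN).mul hll.sqrt
  have hb := tendsto_bSeq_div.mono_left hl
  have h4 := (hsq.mul ((hq.add hb).inv₀ (by positivity))).const_mul 2
  simp only [zero_mul, mul_zero] at h4
  refine h4.congr' ?_
  filter_upwards [hl eventually_bSeq_sq, hlog.eventually_gt_atTop 0, hN.eventually_gt_atTop 1,
    hl (eventually_ge_atTop 1),
    (tendsto_halfNormalQuantile.comp
      ((tendsto_div_atTop_nhdsGT_zero one_pos).comp hN)).eventually_gt_atTop 0]
    with n hbn hL hN1 hn hq0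
  have hn0 : (n : ℝ) ≠ 0 := by positivity
  have hLN := Real.log_pos hN1
  simp only [Function.comp_apply] at hq0 ⊢
  set q := halfNormalQuantile (1 / N n)
  -- the logarithms add up to the difference of the squares
  have e1 : Real.log (√(Real.pi * Real.log (N n)) / N n * expQuantile (1 / N n)) +
      Real.log (N n / n) - Real.log (Real.log (N n) / Real.log n) / 2
      = q ^ 2 / 2 - bSeq n ^ 2 / 2 := by
    have hN0 : N n ≠ 0 := by positivity
    rw [Real.log_mul (by positivity) (expQuantile_pos _).ne', Real.log_div (by positivity) hN0,
      Real.log_div hN0 hn0, Real.log_div hLN.ne' hL.ne', Real.log_sqrt (by positivity),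
      Real.log_mul Real.pi_ne_zero hLN.ne', hbn.1, Real.log_mul Real.pi_ne_zero hL.ne',
      expQuantile, Real.log_exp]
    ring
  have e2 : q / √(Real.log (N n)) * √(Real.log (N n) / Real.log n) = q / √(Real.log n) := by
    rw [Real.sqrt_div' _ hL.le]
    field_simp
  rw [e1, e2, ← add_div, inv_div]
  have : q + bSeq n ≠ 0 := (add_pos_of_pos_of_nonneg hq0 hbn.2).ne'
  field_simp
  ring

end Centring

/-! ### The limit theorem for a deterministic arrival sequence -/

/-- The statistic `(1/n) ∑_{k ≤ n} expQuantile (Γ_k / Γ_{n+1})`, where `Γ_k = e_1 + ⋯ + e_k` are the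
arrival times of the Poisson process with waiting times `e`. -/
noncomputable def arrivalMean (n : ℕ) (e : ℕ → ℝ) : ℝ :=
  (1 / (n : ℝ)) * ∑ k ∈ Finset.range n,
    expQuantile ((∑ s ∈ Finset.range (k + 1), e s) / ∑ s ∈ Finset.range (n + 1), e s)

section Deterministic

variable {e : ℕ → ℝ}

/-- Positive arrival times growing linearly are bounded below by a linear function. -/
lemma exists_mul_le_sum (hpos : ∀ k, 0 < e k)
    (hlim : Tendsto (fun k : ℕ => (∑ s ∈ Finset.range (k + 1), e s) / (k + 1)) atTop (𝓝 1)) :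
    ∃ c : ℝ, 0 < c ∧ c ≤ 1 ∧ ∀ k : ℕ, c * (k + 1) ≤ ∑ s ∈ Finset.range (k + 1), e s := by
  obtain ⟨B, hB⟩ := (hlim.inv₀ one_ne_zero).bddAbove_range
  refine ⟨1 / max B 1, by positivity, ?_, fun k => ?_⟩
  · rw [div_le_one (by positivity)]
    exact le_max_right _ _
  · have h1 : ((∑ s ∈ Finset.range (k + 1), e s) / ((k : ℝ) + 1))⁻¹ ≤ max B 1 :=
      (hB ⟨k, rfl⟩).trans (le_max_left _ _)
    have h2 : 0 < ∑ s ∈ Finset.range (k + 1), e s :=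
      Finset.sum_pos (fun s _ => hpos s) (by simp)
    rw [inv_div, div_le_iff₀ h2] at h1
    rw [div_mul_eq_mul_div, one_mul, div_le_iff₀ (by positivity)]
    linarith

lemma summable_zetaTerm (hpos : ∀ k, 0 < e k)
    (hlim : Tendsto (fun k : ℕ => (∑ s ∈ Finset.range (k + 1), e s) / (k + 1)) atTop (𝓝 1))
    (hsum : Summable fun k : ℕ => (|(∑ s ∈ Finset.range (k + 1), e s) - (k + 1)| + 1) *
      ((k : ℝ) + 1) ^ (-(7 / 4) : ℝ)) : Summable (zetaTerm e) := by
  obtain ⟨c, hc, hc1, hcg⟩ := exists_mul_le_sum hpos hlim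
  refine Summable.of_norm_bounded (hsum.mul_left (1 / c)) fun k => ?_
  set s := ∑ s ∈ Finset.range (k + 1), e s with hs
  have hk : (0 : ℝ) < k + 1 := by positivity
  have hk1 : (1 : ℝ) ≤ k + 1 := by linarith [(Nat.cast_nonneg k : (0 : ℝ) ≤ k)]
  have h1 : c * (k + 1) ≤ s := hcg k
  have hs0 : 0 < s := lt_of_lt_of_le (by positivity) h1
  rw [zetaTerm, ← hs, Real.norm_eq_abs]
  have e1 : s⁻¹ - 1 / ((k : ℝ) + 1) = (k + 1 - s) / (s * (k + 1)) := by field_simp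
  rw [e1, abs_div, abs_of_pos (by positivity : 0 < s * ((k : ℝ) + 1)), abs_sub_comm]
  have e2 : ((k : ℝ) + 1) ^ (-(7 / 4) : ℝ) = ((k : ℝ) + 1) ^ (1 / 4 : ℝ) / ((k : ℝ) + 1) ^ 2 := by
    rw [← Real.rpow_natCast, ← Real.rpow_sub hk]
    norm_num
  have e3 : (1 : ℝ) ≤ ((k : ℝ) + 1) ^ (1 / 4 : ℝ) := Real.one_le_rpow hk1 (by norm_num)
  calc |s - (k + 1)| / (s * (k + 1)) ≤ (|s - (k + 1)| + 1) / ((c * (k + 1)) * (k + 1)) := by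
        gcongr; linarith
    _ = 1 / c * ((|s - (k + 1)| + 1) * (1 / ((k : ℝ) + 1) ^ 2)) := by field_simp
    _ ≤ _ := by
        rw [e2]
        gcongr

variable {l : Filter ℕ}

/-- Dominated convergence for the centred sum over the arrival times, compared with the integral of
`expQuantile` over `[1 / Γ_{n+1}, (n + 1) / Γ_{n+1}]`. -/
lemma tendsto_centred_sum (hpos : ∀ k, 0 < e k)
    (hlim : Tendsto (fun k : ℕ => (∑ s ∈ Finset.range (k + 1), e s) / (k + 1)) atTop (𝓝 1))
    (hsum : Summable fun k : ℕ => (|(∑ s ∈ Finset.range (k + 1), e s) - (k + 1)| + 1) *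
      ((k : ℝ) + 1) ^ (-(7 / 4) : ℝ)) (hl : l ≤ atTop) {N : ℕ → ℝ} (hN : Tendsto N l atTop) :
    Tendsto (fun n : ℕ => √(Real.pi * Real.log (N n)) / N n *
      ((∑ k ∈ Finset.range n, expQuantile ((∑ s ∈ Finset.range (k + 1), e s) / N n)) -
        N n * (quantilePrimitive (1 / N n) - quantilePrimitive ((n + 1) / N n)))) l
      (𝓝 (zetaCirc e)) := by
  obtain ⟨c, hc, hc1, hcg⟩ := exists_mul_le_sum hpos hlim
  obtain ⟨C, hC, hmaj⟩ := exists_expQuantile_sub_majorant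
  set g : ℕ → ℝ := fun k => ∑ s ∈ Finset.range (k + 1), e s with hg
  set F : ℕ → ℕ → ℝ := fun n k => if k < n then √(Real.pi * Real.log (N n)) / N n *
    (expQuantile (g k / N n) - N n *
      (quantilePrimitive ((k + 1) / N n) - quantilePrimitive ((k + 2) / N n))) else 0 with hF
  have hlimit : ∑' k : ℕ, (1 / g k - Real.log (((k : ℝ) + 2) / (k + 1))) = zetaCirc e := by
    rw [zetaCirc, ← hasSum_eulerMascheroni.tsum_eq,
      ← (summable_zetaTerm hpos hlim hsum).tsum_add hasSum_eulerMascheroni.summable]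
    refine tsum_congr fun k => ?_
    simp only [zetaTerm, hg]
    ring
  rw [← hlimit]
  have hT : Tendsto (fun n => ∑' k, F n k) l
      (𝓝 (∑' k : ℕ, (1 / g k - Real.log (((k : ℝ) + 2) / (k + 1))))) := by
    refine tendsto_tsum_of_dominated_convergence (hsum.mul_left (C / c ^ 2)) (fun k => ?_) ?_
    · have hgk : 0 < g k := lt_of_lt_of_le (by positivity) (hcg k)
      have h1 := ((tendsto_expQuantile_div hgk).sub (tendsto_quantilePrimitive_sub
        (by positivity : (0 : ℝ) < k + 1) (by positivity : (0 : ℝ) < k + 2))).comp hN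
      refine h1.congr' ?_
      filter_upwards [hl (eventually_gt_atTop k), hN.eventually_gt_atTop 0] with n hn hN0
      simp only [hF, if_pos hn, Function.comp_apply]
      field_simp
    · filter_upwards [hN.eventually_ge_atTop 1] with n hN1 k
      simp only [hF]
      split_ifs
      · rw [Real.norm_eq_abs, abs_mul, abs_of_nonneg (by positivity)]
        exact hmaj (N n) c (g k) k hN1 hc hc1 (hcg k)
      · rw [norm_zero]
        positivity
  refine hT.congr fun n => ?_
  rw [tsum_eq_sum (s := Finset.range n) fun k hk => by
    simp only [hF, if_neg (fun h => hk (Finset.mem_range.2 h))]]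
  have h2 : ∀ k ∈ Finset.range n, F n k = √(Real.pi * Real.log (N n)) / N n *
      (expQuantile (g k / N n) - N n * (quantilePrimitive (((k : ℕ) + 1) / N n)
        - quantilePrimitive (((k + 1 : ℕ) + 1) / N n))) := by
    intro k hk
    simp only [hF, if_pos (Finset.mem_range.1 hk)]
    push_cast
    rw [show (k : ℝ) + 1 + 1 = k + 2 by ring]
  rw [Finset.sum_congr rfl h2, ← Finset.mul_sum, Finset.sum_sub_distrib, ← Finset.mul_sum,
    Finset.sum_range_sub' fun k : ℕ => quantilePrimitive (((k : ℕ) + 1) / N n)]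
  simp [hg]

/-- The limit theorem for `arrivalMean`, along any filter on which `Γ_{n+1}` is close to `n`. -/
lemma tendsto_arrivalMean (hpos : ∀ k, 0 < e k)
    (hlim : Tendsto (fun k : ℕ => (∑ s ∈ Finset.range (k + 1), e s) / (k + 1)) atTop (𝓝 1))
    (hsum : Summable fun k : ℕ => (|(∑ s ∈ Finset.range (k + 1), e s) - (k + 1)| + 1) *
      ((k : ℝ) + 1) ^ (-(7 / 4) : ℝ)) (hl : l ≤ atTop)
    (hR : Tendsto (fun n : ℕ => Real.log n *
      (|(∑ s ∈ Finset.range (n + 1), e s) - (n + 1)| / n)) l (𝓝 0)) :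
    Tendsto (fun n : ℕ => √(Real.log n) * (arrivalMean n e -
      √(2 / Real.pi) * (bSeq n + zetaCirc e / bSeq n))) l (𝓝 0) := by
  set N : ℕ → ℝ := fun n => ∑ s ∈ Finset.range (n + 1), e s with hNdef
  have hr := tendsto_div_natCast (N := N) hl hR
  have hLr := tendsto_log_mul_div_sub_one (N := N) hl hR
  have hN := tendsto_atTop_of_div_natCast hl hr
  have hll := tendsto_log_div_log hl hr
  have hD := tendsto_centred_sum hpos hlim hsum hl hN
  have hlog : Tendsto (fun n : ℕ => Real.log n) l atTop :=
    (Real.tendsto_log_atTop.comp tendsto_natCast_atTop_atTop).mono_left hl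
  have hq := ((tendsto_halfNormalQuantile_div_sqrt_log one_pos).comp hN).mul hll.sqrt
  have hb := tendsto_bSeq_div.mono_left hl
  have hpi := Real.pi_pos
  -- the fluctuation term
  have hF1 := (hr.mul hD).mul (((hll.const_mul Real.pi).sqrt).inv₀ (by positivity))
  -- the integral of `expQuantile` from `(n + 1) / Γ_{n+1}` to `1` is negligible
  have hF2 : Tendsto (fun n : ℕ => √(Real.log n) * (N n / n) *
      quantilePrimitive ((n + 1) / N n)) l (𝓝 0) := by
    have h1 : Tendsto (fun n : ℕ => expQuantile (1 / 2) * (Real.log n * (|N n - (n + 1)| / n))) l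
        (𝓝 0) := by simpa using hR.const_mul (expQuantile (1 / 2))
    refine squeeze_zero_norm' ?_ h1
    filter_upwards [hl (eventually_ge_atTop 1), hN.eventually_gt_atTop 0,
      hr.eventually (gt_mem_nhds (by norm_num : (1 : ℝ) < 2)), hlog.eventually_ge_atTop 1]
      with n hn hN0 hn2 hL
    have hn0 : (0 : ℝ) < n := by positivity
    set w := ((n : ℝ) + 1) / N n with hw
    have hw2 : 1 / 2 ≤ w := by
      rw [div_lt_iff₀ hn0] at hn2
      rw [hw, div_le_div_iff₀ two_pos hN0]
      linarith
    have hw0 : 0 < w := by linarith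
    have hJ : |quantilePrimitive w| ≤ |w - 1| * expQuantile (1 / 2) := by
      have hK := one_le_expQuantile (1 / 2)
      rcases le_total w 1 with h | h
      · have h2 := quantilePrimitive_sub_bounds hw0 h
        rw [quantilePrimitive_one, sub_zero] at h2
        have h3 : 0 ≤ (1 - w) * expQuantile 1 :=
          mul_nonneg (by linarith) (expQuantile_pos _).le
        rw [abs_of_nonneg (h3.trans h2.1), abs_sub_comm, abs_of_nonneg (by linarith)]
        refine h2.2.trans ?_
        have h4 : expQuantile w ≤ expQuantile (1 / 2) :=
          antitoneOn_expQuantile (by norm_num : (0 : ℝ) < 1 / 2) hw0 hw2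
        have : 0 ≤ 1 - w := by linarith
        gcongr
      · rw [quantilePrimitive, halfNormalQuantile_of_one_le h, mul_zero, zero_sub, abs_neg,
          max_eq_left (by linarith)]
        exact le_mul_of_one_le_right (abs_nonneg _) hK
    have hw1 : |w - 1| = |N n - (n + 1)| / N n := by
      rw [hw, div_sub_one hN0.ne', abs_div, abs_of_pos hN0, abs_sub_comm]
    have hsL : √(Real.log n) ≤ Real.log n := by
      rw [Real.sqrt_le_left (by linarith)]
      nlinarith
    rw [Real.norm_eq_abs, abs_mul, abs_of_nonneg (by positivity)]
    calc √(Real.log n) * (N n / n) * |quantilePrimitive w|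
        ≤ Real.log n * (N n / n) * (|N n - (n + 1)| / N n * expQuantile (1 / 2)) := by
          rw [← hw1]; gcongr
      _ = _ := by field_simp
  have hF3 := (hLr.mul hq).const_mul √(2 / Real.pi)
  have hF4 := (tendsto_quantile_sub_bSeq hl hr).const_mul √(2 / Real.pi)
  have hF5 := (hb.inv₀ (by positivity)).const_mul (√(2 / Real.pi) * zetaCirc e)
  have hall := (((hF1.sub hF2).add hF3).add hF4).sub hF5
  have hz : 1 * zetaCirc e * (√(Real.pi * 1))⁻¹ - 0 + √(2 / Real.pi) * (0 * (√2 * √1)) +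
      √(2 / Real.pi) * 0 - √(2 / Real.pi) * zetaCirc e * (√2)⁻¹ = 0 := by
    rw [Real.sqrt_div' _ hpi.le, mul_one]
    field_simp
    ring
  rw [hz] at hall
  refine hall.congr' ?_
  filter_upwards [hl (eventually_ge_atTop 1), hN.eventually_gt_atTop 1, hlog.eventually_ge_atTop 1,
    hb.eventually (lt_mem_nhds (by positivity : 0 < √2))] with n hn hN1 hL hbn
  have hn0 : (0 : ℝ) < n := by positivity
  have hLN := Real.log_pos hN1
  have hb0 : bSeq n ≠ 0 := fun h => by simp [h] at hbn
  have hJ1 : quantilePrimitive (1 / N n) = √(2 / Real.pi) * halfNormalQuantile (1 / N n) := by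
    have : 1 / N n - 1 ≤ 0 := by
      rw [sub_nonpos, div_le_one (by linarith)]
      exact hN1.le
    rw [quantilePrimitive, max_eq_right this, sub_zero]
  have hA : arrivalMean n e =
      1 / n * ∑ k ∈ Finset.range n, expQuantile ((∑ s ∈ Finset.range (k + 1), e s) / N n) := rfl
  simp only [Function.comp_apply]
  rw [hA, hJ1]
  set S := ∑ k ∈ Finset.range n, expQuantile ((∑ s ∈ Finset.range (k + 1), e s) / N n)
  set q := halfNormalQuantile (1 / N n)
  set J := quantilePrimitive ((n + 1) / N n)
  set t := √(2 / Real.pi)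
  set b := bSeq n
  rw [Real.sqrt_div' _ (by linarith), ← mul_div_assoc, Real.sqrt_div' _ (by linarith),
    Real.sqrt_mul hpi.le]
  have hx : 0 < √(Real.log n) := by positivity
  have hxx : Real.log n = √(Real.log n) ^ 2 := (Real.sq_sqrt (by linarith)).symm
  set x := √(Real.log n)
  rw [hxx]
  have hy : 0 < √(Real.log (N n)) := by positivity
  set y := √(Real.log (N n))
  have hNn : N n ≠ 0 := by positivity
  field_simp
  ring

end Deterministic

/-! ### Sums of independent exponential variables -/

lemma expMeasure_one_eq : expMeasure 1 =
    (volume.restrict (Set.Ioi 0)).withDensity fun x => ENNReal.ofReal (Real.exp (-x)) := by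
  rw [← withDensity_indicator measurableSet_Ioi]
  change volume.withDensity (exponentialPDF 1) = _
  refine withDensity_congr_ae ?_
  have h0 : ∀ᵐ x : ℝ, x ≠ 0 := by simp [ae_iff]
  filter_upwards [h0] with x hx
  rw [exponentialPDF_eq, Set.indicator_apply]
  rcases hx.lt_or_gt with h | h
  · simp [h.not_ge, h.le]
  · simp [h, h.le]

instance isProbabilityMeasure_expMeasure_one : IsProbabilityMeasure (expMeasure 1) :=
  isProbabilityMeasure_expMeasure one_pos

lemma ae_pos_expMeasure : ∀ᵐ x ∂expMeasure 1, 0 < x := by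
  rw [expMeasure_one_eq]
  exact (withDensity_absolutelyContinuous _ _).ae_le (ae_restrict_mem measurableSet_Ioi)

lemma integrable_pow_expMeasure (n : ℕ) : Integrable (fun x => x ^ n) (expMeasure 1) := by
  rw [expMeasure_one_eq, integrable_withDensity_iff (by fun_prop) (by simp)]
  have h := Real.GammaIntegral_convergent (s := n + 1) (by positivity)
  refine h.congr_fun (fun x hx => ?_) measurableSet_Ioi
  simp only [add_sub_cancel_right, Real.rpow_natCast, ENNReal.toReal_ofReal (Real.exp_pos _).le]
  ring

lemma integral_pow_expMeasure (n : ℕ) : ∫ x, x ^ n ∂expMeasure 1 = n.factorial := by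
  rw [expMeasure_one_eq, integral_withDensity_eq_integral_toReal_smul (by fun_prop) (by simp),
    ← Real.Gamma_nat_eq_factorial, Real.Gamma_eq_integral (by positivity)]
  simp [ENNReal.toReal_ofReal (Real.exp_pos _).le]

section Exponential

variable {Ω : Type*} [MeasurableSpace Ω] {μ : Measure Ω} {e : ℕ → Ω → ℝ}

lemma IsIID.ae_pos (he : IsIID e (expMeasure 1) μ) : ∀ᵐ ω ∂μ, ∀ k, 0 < e k ω :=
  ae_all_iff.2 fun k => by
    have := ae_pos_expMeasure
    rw [← (he.1 k).map_eq] at this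
    exact ae_of_ae_map (he.1 k).aemeasurable this

lemma IsIID.integral_exp (he : IsIID e (expMeasure 1) μ) (k : ℕ) : ∫ ω, e k ω ∂μ = 1 := by
  rw [(he.1 k).integral_eq]
  simpa using integral_pow_expMeasure 1

lemma IsIID.memLp_exp (he : IsIID e (expMeasure 1) μ) (k : ℕ) : MemLp (e k) 2 μ := by
  have h : MemLp id 2 (expMeasure 1) :=
    (memLp_two_iff_integrable_sq measurable_id.aestronglyMeasurable).2 (integrable_pow_expMeasure 2)
  rw [← (he.1 k).map_eq] at h
  exact (memLp_map_measure_iff h.1 (he.1 k).aemeasurable).1 h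

/-- A series of nonnegative random variables with summable expectations converges almost surely. -/
lemma ae_summable_of_summable_integral {f : ℕ → Ω → ℝ} (hf : ∀ k, Integrable (f k) μ)
    (hf0 : ∀ k ω, 0 ≤ f k ω) (hsum : Summable fun k => ∫ ω, f k ω ∂μ) :
    ∀ᵐ ω ∂μ, Summable fun k => f k ω := by
  have h1 : ∫⁻ ω, ∑' k, ENNReal.ofReal (f k ω) ∂μ ≠ ⊤ := by
    rw [lintegral_tsum fun k => (hf k).aemeasurable.ennreal_ofReal]
    simp_rw [← fun k => ofReal_integral_eq_lintegral_ofReal (hf k) (ae_of_all _ (hf0 k))]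
    rw [← ENNReal.ofReal_tsum_of_nonneg (fun k => integral_nonneg (hf0 k)) hsum]
    exact ENNReal.ofReal_ne_top
  have h2 := ae_lt_top' (AEMeasurable.tsum fun k => (hf k).aemeasurable.ennreal_ofReal) h1
  filter_upwards [h2] with ω hω
  refine (ENNReal.summable_toReal hω.ne).congr fun k => ?_
  rw [ENNReal.toReal_ofReal (hf0 k ω)]

lemma IsIID.aemeasurable_arrivalMean (he : IsIID e (expMeasure 1) μ) (n : ℕ) :
    AEMeasurable (fun ω => arrivalMean n fun s => e s ω) μ := by
  have hm := fun i => (he.1 i).aemeasurable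
  refine AEMeasurable.const_mul (Finset.aemeasurable_fun_sum _ fun k _ => ?_) _
  exact measurable_expQuantile.comp_aemeasurable
    ((Finset.aemeasurable_fun_sum _ fun s _ => hm s).div
      (Finset.aemeasurable_fun_sum _ fun s _ => hm s))

variable [IsProbabilityMeasure μ]

lemma IsIID.variance_exp (he : IsIID e (expMeasure 1) μ) (k : ℕ) : variance (e k) μ = 1 := by
  rw [variance_eq_sub (he.memLp_exp k), he.integral_exp]
  have h : ∫ ω, e k ω ^ 2 ∂μ = ∫ x, x ^ 2 ∂expMeasure 1 := by
    rw [← (he.1 k).map_eq, integral_map (he.1 k).aemeasurable (by fun_prop)]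
  simp only [Pi.pow_apply]
  rw [h, integral_pow_expMeasure]
  norm_num

lemma IsIID.ae_tendsto_sum_div (he : IsIID e (expMeasure 1) μ) : ∀ᵐ ω ∂μ,
    Tendsto (fun k : ℕ => (∑ s ∈ Finset.range (k + 1), e s ω) / (k + 1)) atTop (𝓝 1) := by
  have h := strong_law_ae_real e ((he.memLp_exp 0).integrable one_le_two)
    (fun i j hij => he.2.indepFun hij)
    (fun i => ⟨(he.1 i).aemeasurable, (he.1 0).aemeasurable,
      (he.1 i).map_eq.trans (he.1 0).map_eq.symm⟩)
  rw [he.integral_exp] at h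
  filter_upwards [h] with ω hω
  refine (hω.comp (tendsto_add_atTop_nat 1)).congr fun k => ?_
  simp

lemma IsIID.integrable_abs_sum_sub (he : IsIID e (expMeasure 1) μ) (k : ℕ) :
    Integrable (fun ω => |(∑ s ∈ Finset.range (k + 1), e s ω) - (k + 1)|) μ :=
  ((integrable_finsetSum _ fun s _ => (he.memLp_exp s).integrable one_le_two).sub
    (integrable_const _)).abs

/-- The mean absolute deviation of `Γ_{k+1}` is at most its standard deviation `√(k + 1)`. -/
lemma IsIID.integral_abs_sum_sub_le (he : IsIID e (expMeasure 1) μ) (k : ℕ) :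
    ∫ ω, |(∑ s ∈ Finset.range (k + 1), e s ω) - (k + 1)| ∂μ ≤ √(k + 1) := by
  set S : Ω → ℝ := ∑ s ∈ Finset.range (k + 1), e s with hS
  have hSω : ∀ ω, ∑ s ∈ Finset.range (k + 1), e s ω = S ω := fun ω => by
    rw [hS, Finset.sum_apply]
  have hSL : MemLp S 2 μ := memLp_finsetSum' _ fun s _ => he.memLp_exp s
  have hmean : ∫ ω, S ω ∂μ = k + 1 := by
    simp_rw [← hSω]
    rw [integral_finsetSum _ fun s _ => (he.memLp_exp s).integrable one_le_two]
    simp [he.integral_exp]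
  have hvar : ∫ ω, (S ω - ((k : ℝ) + 1)) ^ 2 ∂μ = (k : ℝ) + 1 := by
    rw [← hmean, ← variance_eq_integral hSL.aemeasurable, hmean, hS,
      IndepFun.variance_sum (fun s _ => he.memLp_exp s) fun i _ j _ hij => he.2.indepFun hij]
    simp [he.variance_exp]
  have hL2 : MemLp (fun ω => S ω - (k + 1)) 2 μ := hSL.sub (memLp_const _)
  have hr : (0 : ℝ) < √(k + 1) := by positivity
  simp_rw [hSω]
  have h1 : ∀ ω, |S ω - (k + 1)| ≤ (S ω - (k + 1)) ^ 2 * (1 / (2 * √(k + 1))) + √(k + 1) / 2 := by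
    intro ω
    have h2 := sq_nonneg (|S ω - (k + 1)| - √(k + 1))
    have h3 := sq_abs (S ω - (k + 1))
    have e1 : (S ω - (k + 1)) ^ 2 * (1 / (2 * √(k + 1))) + √(k + 1) / 2
        = ((S ω - (k + 1)) ^ 2 + √(k + 1) ^ 2) / (2 * √(k + 1)) := by
      field_simp
    rw [e1, le_div_iff₀ (by positivity)]
    linarith
  have h4 : Integrable (fun ω => (S ω - (k + 1)) ^ 2 * (1 / (2 * √((k : ℝ) + 1)))) μ :=
    hL2.integrable_sq.mul_const _
  refine (integral_mono (hL2.integrable one_le_two).abs (h4.add (integrable_const _)) h1).trans ?_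
  simp only [Pi.add_apply]
  rw [integral_add h4 (integrable_const _), integral_mul_const, hvar]
  simp only [integral_const, probReal_univ, smul_eq_mul, one_mul]
  have h5 : ((k : ℝ) + 1) = √(k + 1) ^ 2 := (Real.sq_sqrt (by positivity)).symm
  have h6 : ((k : ℝ) + 1) * (1 / (2 * √(k + 1))) = √(k + 1) / 2 := by
    nth_rewrite 1 [h5]
    field_simp
  rw [h6]
  linarith

lemma IsIID.ae_summable_majorant (he : IsIID e (expMeasure 1) μ) : ∀ᵐ ω ∂μ,
    Summable fun k : ℕ => (|(∑ s ∈ Finset.range (k + 1), e s ω) - (k + 1)| + 1) *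
      ((k : ℝ) + 1) ^ (-(7 / 4) : ℝ) := by
  refine ae_summable_of_summable_integral
    (fun k => ((he.integrable_abs_sum_sub k).add (integrable_const _)).mul_const _)
    (fun k ω => by positivity) ?_
  have hs : Summable fun k : ℕ => 2 * ((k + 1 : ℕ) : ℝ) ^ (-(5 / 4) : ℝ) :=
    ((summable_nat_add_iff 1).2 (Real.summable_nat_rpow.2 (by norm_num))).mul_left 2
  refine hs.of_nonneg_of_le (fun k => integral_nonneg fun ω => by positivity) fun k => ?_
  rw [integral_mul_const, integral_add (he.integrable_abs_sum_sub k) (integrable_const _)]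
  have hk : (0 : ℝ) < k + 1 := by positivity
  have hk1 : (1 : ℝ) ≤ k + 1 := by linarith [(Nat.cast_nonneg k : (0 : ℝ) ≤ k)]
  have h1 := he.integral_abs_sum_sub_le k
  have h2 : 1 ≤ √((k : ℝ) + 1) := Real.one_le_sqrt.2 hk1
  have h3 : ((k + 1 : ℕ) : ℝ) ^ (-(5 / 4) : ℝ) =
      √((k : ℝ) + 1) * ((k : ℝ) + 1) ^ (-(7 / 4) : ℝ) := by
    rw [Real.sqrt_eq_rpow, ← Real.rpow_add hk]
    push_cast
    norm_num
  rw [h3, ← mul_assoc]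
  simp only [integral_const, probReal_univ, smul_eq_mul, one_mul]
  gcongr
  linarith

/-- The absolute fluctuations of `Γ_{n+1}` are of order `√n`, hence `o(n / log n)` in measure. -/
lemma IsIID.tendstoInMeasure_log_mul (he : IsIID e (expMeasure 1) μ) :
    TendstoInMeasure μ (fun (n : ℕ) ω => Real.log n *
      (|(∑ s ∈ Finset.range (n + 1), e s ω) - (n + 1)| / n)) atTop (fun _ => 0) := by
  have hi : ∀ n : ℕ, Integrable (fun ω => Real.log n *
      (|(∑ s ∈ Finset.range (n + 1), e s ω) - (n + 1)| / n)) μ := fun n =>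
    ((he.integrable_abs_sum_sub n).div_const _).const_mul _
  refine tendstoInMeasure_of_tendsto_eLpNorm one_ne_zero (fun n => (hi n).aestronglyMeasurable)
    aestronglyMeasurable_const ?_
  have h1 : ∀ n : ℕ, eLpNorm ((fun ω => Real.log n *
      (|(∑ s ∈ Finset.range (n + 1), e s ω) - (n + 1)| / n)) - fun _ => 0) 1 μ
      ≤ ENNReal.ofReal (Real.log n * (√(n + 1) / n)) := by
    intro n
    have h0 : ∀ ω, 0 ≤ Real.log n * (|(∑ s ∈ Finset.range (n + 1), e s ω) - (n + 1)| / n) :=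
      fun ω => mul_nonneg (Real.log_natCast_nonneg n) (by positivity)
    rw [show (fun _ : Ω => (0 : ℝ)) = 0 from rfl, sub_zero, eLpNorm_one_eq_lintegral_enorm,
      ← ofReal_integral_norm_eq_lintegral_enorm (hi n)]
    refine ENNReal.ofReal_le_ofReal ?_
    simp_rw [Real.norm_of_nonneg (h0 _)]
    rw [integral_const_mul, integral_div]
    have := Real.log_natCast_nonneg n
    gcongr
    exact he.integral_abs_sum_sub_le n
  have h2 : Tendsto (fun n : ℕ => Real.log n * (√(n + 1) / n)) atTop (𝓝 0) := by
    have h3 : Tendsto (fun x : ℝ => Real.log x / x ^ (1 / 2 : ℝ)) atTop (𝓝 0) :=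
      (isLittleO_log_rpow_atTop (by norm_num)).tendsto_div_nhds_zero
    have h4 := (h3.comp tendsto_natCast_atTop_atTop).mul_const √2
    rw [zero_mul] at h4
    refine squeeze_zero' (Eventually.of_forall fun n =>
      mul_nonneg (Real.log_natCast_nonneg n) (by positivity)) ?_ h4
    filter_upwards [eventually_ge_atTop 1] with n hn
    have hn1 : (1 : ℝ) ≤ n := by exact_mod_cast hn
    have hL := Real.log_natCast_nonneg n
    have hx : (n : ℝ) = √n ^ 2 := (Real.sq_sqrt (by positivity)).symm
    have h5 : √((n : ℝ) + 1) ≤ √n * √2 := by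
      rw [← Real.sqrt_mul (by positivity)]
      exact Real.sqrt_le_sqrt (by linarith)
    simp only [Function.comp_apply, ← Real.sqrt_eq_rpow]
    calc Real.log n * (√(n + 1) / n) ≤ Real.log n * (√n * √2 / n) := by gcongr
      _ = Real.log n / √n * √2 := by
        have : √(n : ℝ) ≠ 0 := by positivity
        nth_rewrite 3 [hx]
        field_simp
  have h3 := ENNReal.tendsto_ofReal h2
  rw [ENNReal.ofReal_zero] at h3
  exact tendsto_of_tendsto_of_tendsto_of_le_of_le tendsto_const_nhds h3 (fun _ => zero_le) h1

lemma IsIID.ae_summable_zetaTerm (he : IsIID e (expMeasure 1) μ) :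
    ∀ᵐ ω ∂μ, Summable (zetaTerm fun s => e s ω) := by
  filter_upwards [he.ae_pos, he.ae_tendsto_sum_div, he.ae_summable_majorant] with ω h1 h2 h3
  exact summable_zetaTerm h1 h2 h3

lemma IsIID.aemeasurable_zetaCirc (he : IsIID e (expMeasure 1) μ) :
    AEMeasurable (fun ω => zetaCirc fun s => e s ω) μ := by
  have hm := fun i => (he.1 i).aemeasurable
  refine AEMeasurable.add_const ?_ _
  refine aemeasurable_of_tendsto_metrizable_ae atTop
    (f := fun n ω => ∑ k ∈ Finset.range n, zetaTerm (fun s => e s ω) k) (fun n => ?_) ?_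
  · refine Finset.aemeasurable_fun_sum _ fun k _ => ?_
    exact ((Finset.aemeasurable_fun_sum _ fun s _ => hm s).inv).sub_const _
  · filter_upwards [he.ae_summable_zetaTerm] with ω h
    exact h.hasSum.tendsto_sum_nat

/-- The limit theorem for `arrivalMean` in probability. Along a subsequence on which `Γ_{n+1}` is
almost surely close to `n`, the convergence holds almost surely. -/
lemma IsIID.eqInProbUpTo_arrivalMean (he : IsIID e (expMeasure 1) μ) :
    EqInProbUpTo μ (fun n ω => arrivalMean n fun s => e s ω)
      (fun n ω => √(2 / Real.pi) * (bSeq n + zetaCirc (fun s => e s ω) / bSeq n))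
      (fun n => 1 / √(Real.log n)) := by
  intro ε hε
  refine tendsto_of_subseq_tendsto fun ns hns => ?_
  have hm : TendstoInMeasure μ (fun (n : ℕ) ω => Real.log (ns n) *
      (|(∑ s ∈ Finset.range (ns n + 1), e s ω) - (ns n + 1)| / ns n)) atTop (fun _ => 0) :=
    fun δ hδ => (he.tendstoInMeasure_log_mul δ hδ).comp hns
  obtain ⟨ms, hms, hae⟩ := hm.exists_seq_tendsto_ae
  refine ⟨ms, ?_⟩
  set φ : ℕ → ℕ := fun n => ns (ms n) with hφ
  have hφl : map φ atTop ≤ atTop := hns.comp hms.tendsto_atTop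
  have hconv : ∀ᵐ ω ∂μ, Tendsto (fun k => √(Real.log (φ k)) * (arrivalMean (φ k) (fun s => e s ω) -
      √(2 / Real.pi) * (bSeq (φ k) + zetaCirc (fun s => e s ω) / bSeq (φ k)))) atTop (𝓝 0) := by
    filter_upwards [he.ae_pos, he.ae_tendsto_sum_div, he.ae_summable_majorant, hae]
      with ω h1 h2 h3 h4
    exact (tendsto_arrivalMean h1 h2 h3 hφl (tendsto_map'_iff.2 h4)).comp tendsto_map
  have hmeas := tendstoInMeasure_of_tendsto_ae (fun k => ?_) hconv
  · rw [tendstoInMeasure_iff_norm] at hmeas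
    refine (hmeas ε hε).congr fun k => ?_
    congr 1
    ext ω
    simp only [Set.mem_ofPred_eq, sub_zero, Real.norm_eq_abs, abs_mul,
      abs_of_nonneg (Real.sqrt_nonneg _), div_div_eq_mul_div, div_one, hφ]
    rw [mul_comm]
  · exact (((he.aemeasurable_arrivalMean _).sub
      ((he.aemeasurable_zetaCirc.div_const _).const_add _ |>.const_mul _)).const_mul
        _).aestronglyMeasurable

end Exponential

/-! ### Order statistics of uniform variables -/

lemma lintegral_fin_prod {n : ℕ} {f : Fin n → ℝ → ENNReal} (hf : ∀ i, Measurable (f i)) :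
    ∫⁻ x : Fin n → ℝ, ∏ i, f i (x i) = ∏ i, ∫⁻ t, f i t := by
  induction n with
  | zero => simp [volume_pi]
  | succ n ih =>
    have hm : Measurable fun p : ℝ × (Fin n → ℝ) => f 0 p.1 * ∏ i : Fin n, f i.succ (p.2 i) := by
      have := fun i => hf i
      fun_prop
    have h := (volume_preserving_piFinSuccAbove (fun _ : Fin (n + 1) => ℝ) 0).lintegral_comp hm
    have e : ∀ x : Fin (n + 1) → ℝ, ∏ i, f i (x i) =
        f 0 (MeasurableEquiv.piFinSuccAbove (fun _ => ℝ) 0 x).1 *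
          ∏ i : Fin n, f i.succ ((MeasurableEquiv.piFinSuccAbove (fun _ => ℝ) 0 x).2 i) := by
      intro x
      rw [Fin.prod_univ_succ]
      rfl
    simp_rw [e]
    refine h.trans ?_
    have hg : Measurable fun z : Fin n → ℝ => ∏ i : Fin n, f i.succ (z i) := by
      have := fun i => hf i
      fun_prop
    rw [Measure.volume_eq_prod, lintegral_prod_mul (hf 0).aemeasurable hg.aemeasurable,
      ih fun i => hf i.succ, Fin.prod_univ_succ]

lemma pi_expMeasure_eq (n : ℕ) : Measure.pi (fun _ : Fin n => expMeasure 1) =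
    (volume : Measure (Fin n → ℝ)).withDensity fun x =>
      ∏ i, (Set.Ioi (0 : ℝ)).indicator (fun t => ENNReal.ofReal (Real.exp (-t))) (x i) := by
  have hd : Measurable ((Set.Ioi (0 : ℝ)).indicator fun t => ENNReal.ofReal (Real.exp (-t))) :=
    Measurable.indicator (by fun_prop) measurableSet_Ioi
  refine Measure.pi_eq fun s hs => ?_
  rw [withDensity_apply _ (MeasurableSet.univ_pi hs),
    ← lintegral_indicator (MeasurableSet.univ_pi hs)]
  have e : ∀ x : Fin n → ℝ, (Set.univ.pi s).indicator (fun x => ∏ i,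
      (Set.Ioi (0 : ℝ)).indicator (fun t => ENNReal.ofReal (Real.exp (-t))) (x i)) x =
      ∏ i, (s i).indicator
        ((Set.Ioi (0 : ℝ)).indicator fun t => ENNReal.ofReal (Real.exp (-t))) (x i) := by
    intro x
    by_cases hx : x ∈ Set.univ.pi s
    · rw [Set.indicator_of_mem hx]
      exact Finset.prod_congr rfl fun i _ => by
        rw [Set.indicator_of_mem (hx i (Set.mem_univ i))]
    · rw [Set.indicator_of_notMem hx]
      simp only [Set.mem_univ_pi, not_forall] at hx
      obtain ⟨i, hi⟩ := hx
      exact (Finset.prod_eq_zero (Finset.mem_univ i) (Set.indicator_of_notMem hi _)).symm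
  simp_rw [e]
  rw [lintegral_fin_prod fun i => hd.indicator (hs i)]
  refine Finset.prod_congr rfl fun i _ => ?_
  rw [lintegral_indicator (hs i), expMeasure_one_eq, ← withDensity_indicator measurableSet_Ioi,
    withDensity_apply _ (hs i)]

/-- The linear map sending a vector to the vector of its partial sums. -/
def partialSums (n : ℕ) : (Fin n → ℝ) →ₗ[ℝ] (Fin n → ℝ) where
  toFun x k := ∑ j ∈ Finset.Iic k, x j
  map_add' x y := by ext k; simp [Finset.sum_add_distrib]
  map_smul' c x := by ext k; simp [Finset.mul_sum]

lemma partialSums_apply (n : ℕ) (x : Fin n → ℝ) (k : Fin n) :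
    partialSums n x k = ∑ j ∈ Finset.Iic k, x j := rfl

lemma partialSums_eq_sum_range {n : ℕ} (e : ℕ → ℝ) (k : Fin n) :
    partialSums n (fun i => e i) k = ∑ s ∈ Finset.range (k + 1), e s := by
  rw [partialSums_apply, Nat.range_succ_eq_Iic, ← Fin.map_valEmbedding_Iic, Finset.sum_map]
  rfl

lemma exists_extension {n : ℕ} (x : Fin n → ℝ) : ∃ e : ℕ → ℝ, x = fun i : Fin n => e i :=
  ⟨fun s => if h : s < n then x ⟨s, h⟩ else 0, by ext i; simp⟩

lemma partialSums_injective (n : ℕ) : Function.Injective (partialSums n) := by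
  rw [injective_iff_map_eq_zero]
  intro x hx
  obtain ⟨e, rfl⟩ := exists_extension x
  have h : ∀ k, k < n → ∑ s ∈ Finset.range (k + 1), e s = 0 := fun k hk => by
    have := congrFun hx ⟨k, hk⟩
    rwa [partialSums_eq_sum_range] at this
  ext ⟨k, hk⟩
  rcases k with _ | k
  · simpa using h 0 hk
  · have h1 := h (k + 1) hk
    rw [Finset.sum_range_succ, h k (by omega), zero_add] at h1
    exact h1

/-- A vector is positive iff its partial sums increase strictly from a positive number. -/
lemma forall_pos_iff_partialSums {n : ℕ} (x : Fin (n + 1) → ℝ) : (∀ i, 0 < x i) ↔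
    (StrictMono fun i : Fin n => partialSums (n + 1) x i.castSucc) ∧
    (∀ i : Fin n, partialSums (n + 1) x i.castSucc ∈
      Set.Ioo 0 (partialSums (n + 1) x (Fin.last n))) ∧ 0 < partialSums (n + 1) x (Fin.last n) := by
  obtain ⟨e, rfl⟩ := exists_extension x
  simp only [partialSums_eq_sum_range, Fin.val_castSucc, Fin.val_last, Set.mem_Ioo]
  constructor
  · intro h
    have hp : ∀ k, k < n + 1 → 0 < e k := fun k hk => h ⟨k, hk⟩
    have hlt : ∀ i j, i < j → j < n + 1 →
        ∑ s ∈ Finset.range (i + 1), e s < ∑ s ∈ Finset.range (j + 1), e s := by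
      intro i j hij hj
      refine Finset.sum_lt_sum_of_subset (i := j)
        (Finset.range_subset_range.2 (by omega)) (by simp) (by simpa using hij)
        (hp j hj) fun s hs _ => (hp s ?_).le
      have := Finset.mem_range.1 hs
      omega
    have h0 : ∀ i, i < n + 1 → 0 < ∑ s ∈ Finset.range (i + 1), e s := fun i hi =>
      Finset.sum_pos (fun s hs => hp s (by have := Finset.mem_range.1 hs; omega)) (by simp)
    exact ⟨fun i j hij => hlt i j hij (by omega), fun i => ⟨h0 i (by omega),
      hlt i n i.2 (by omega)⟩, h0 n (by omega)⟩
  · rintro ⟨h1, h2, h3⟩ ⟨k, hk⟩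
    change 0 < e k
    rcases k with _ | k
    · rcases Nat.eq_zero_or_pos n with rfl | hn
      · simpa using h3
      · simpa using (h2 ⟨0, hn⟩).1
    · have hlt : ∑ s ∈ Finset.range (k + 1), e s < ∑ s ∈ Finset.range (k + 1 + 1), e s := by
        rcases Nat.lt_or_ge (k + 1) n with h | h
        · exact @h1 ⟨k, by omega⟩ ⟨k + 1, h⟩ (by simp [Fin.lt_def])
        · have : k + 1 = n := by omega
          subst this
          exact (h2 ⟨k, by omega⟩).2
      rw [Finset.sum_range_succ _ (k + 1)] at hlt
      linarith

lemma ae_injective_fin (n : ℕ) : ∀ᵐ x : Fin n → ℝ, Function.Injective x := by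
  have h : ∀ i j : Fin n, i ≠ j → ∀ᵐ x : Fin n → ℝ, x i ≠ x j := by
    intro i j hij
    set s : Submodule ℝ (Fin n → ℝ) :=
      LinearMap.ker ((LinearMap.proj i : (Fin n → ℝ) →ₗ[ℝ] ℝ) - LinearMap.proj j) with hs
    have hst : s ≠ ⊤ := by
      intro h
      have : (Pi.single i 1 : Fin n → ℝ) ∈ s := h ▸ Submodule.mem_top
      simp [hs, LinearMap.mem_ker, hij.symm] at this
    have h0 := Measure.addHaar_submodule (volume : Measure (Fin n → ℝ)) s hst
    refine measure_mono_null (fun x hx => ?_) h0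
    simpa [hs, LinearMap.mem_ker, sub_eq_zero] using hx
  have h2 : ∀ᵐ x : Fin n → ℝ, ∀ i j : Fin n, i ≠ j → x i ≠ x j := by
    simp only [ae_all_iff]
    exact fun i j hij => h i j hij
  filter_upwards [h2] with x hx i j hij
  by_contra hne
  exact hx i j hne hij

lemma measurableSet_strictMono (n : ℕ) : MeasurableSet {x : Fin n → ℝ | StrictMono x} := by
  have : {x : Fin n → ℝ | StrictMono x} = ⋂ i, ⋂ j, {x | i < j → x i < x j} := by
    ext x
    simp [StrictMono]
  rw [this]
  refine MeasurableSet.iInter fun i => MeasurableSet.iInter fun j => ?_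
  by_cases hij : i < j
  · simp only [hij, true_imp_iff]
    exact measurableSet_lt (measurable_pi_apply i) (measurable_pi_apply j)
  · simp [hij]

/-- A symmetric function integrates over `ℝⁿ` to `n!` times its integral over the cone of strictly
increasing vectors, because almost every vector is increasing after exactly one permutation. -/
lemma lintegral_eq_factorial_mul_lintegral_strictMono {n : ℕ} {Φ : (Fin n → ℝ) → ENNReal}
    (hΦ : Measurable Φ) (hsymm : ∀ (σ : Equiv.Perm (Fin n)) x, Φ (x ∘ σ) = Φ x) :
    ∫⁻ x, Φ x = n.factorial * ∫⁻ x in {x | StrictMono x}, Φ x := by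
  set s : Set (Fin n → ℝ) := {x | StrictMono x} with hs
  have hsm : MeasurableSet s := measurableSet_strictMono n
  have h1 : ∀ᵐ x : Fin n → ℝ, Φ x = ∑ σ : Equiv.Perm (Fin n), s.indicator Φ (x ∘ σ) := by
    filter_upwards [ae_injective_fin n] with x hx
    rw [Finset.sum_eq_single (Tuple.sort x)]
    · have : x ∘ Tuple.sort x ∈ s :=
        (Tuple.monotone_sort x).strictMono_of_injective (hx.comp (Tuple.sort x).injective)
      rw [Set.indicator_of_mem this, hsymm]
    · intro σ _ hσ
      refine Set.indicator_of_notMem (fun h => hσ ?_) _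
      have h2 := Tuple.unique_monotone (StrictMono.monotone h) (Tuple.monotone_sort x)
      exact Equiv.ext fun i => hx (congrFun h2 i)
    · simp
  have h2 : ∀ σ : Equiv.Perm (Fin n), ∫⁻ x, s.indicator Φ (x ∘ σ) = ∫⁻ x in s, Φ x := by
    intro σ
    have h3 := (volume_measurePreserving_piCongrLeft (fun _ : Fin n => ℝ) σ.symm).lintegral_comp
      (hΦ.indicator hsm)
    rw [← lintegral_indicator hsm, ← h3]
    refine lintegral_congr fun x => ?_
    congr 1
    ext i
    have := MeasurableEquiv.piCongrLeft_apply_apply (β := fun _ : Fin n => ℝ) σ.symm x (σ i)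
    simpa using this.symm
  rw [lintegral_congr_ae h1, lintegral_finsetSum]
  · simp_rw [h2]
    simp [Fintype.card_perm]
  · intro σ _
    exact (hΦ.indicator hsm).comp (by fun_prop)

/-- Scaling of the Lebesgue integral over `ℝⁿ`. -/
lemma lintegral_comp_smul_fin {n : ℕ} {Φ : (Fin n → ℝ) → ENNReal} (hΦ : Measurable Φ) {t : ℝ}
    (ht : 0 < t) : ∫⁻ z : Fin n → ℝ, Φ (t⁻¹ • z) = ENNReal.ofReal (t ^ n) * ∫⁻ u, Φ u := by
  have h := Measure.map_addHaar_smul (volume : Measure (Fin n → ℝ)) (inv_ne_zero ht.ne')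
  rw [← lintegral_map hΦ (by fun_prop : Measurable fun z : Fin n → ℝ => t⁻¹ • z), h,
    lintegral_smul_measure]
  simp [abs_of_pos ht]

lemma indicator_eq_indicator_of_iff {α β M : Type*} [Zero M] {s : Set α} {t : Set β} {f : α → M}
    {g : β → M} {a : α} {b : β} (h : a ∈ s ↔ b ∈ t) (hfg : f a = g b) :
    s.indicator f a = t.indicator g b := by
  by_cases ha : a ∈ s
  · rw [Set.indicator_of_mem ha, Set.indicator_of_mem (h.1 ha), hfg]
  · rw [Set.indicator_of_notMem ha, Set.indicator_of_notMem fun hb => ha (h.2 hb)]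

/-- The integral against the law of `(Γ_1, …, Γ_{n+1})`, up to a constant. -/
lemma exists_lintegral_partialSums_eq (n : ℕ) : ∃ c : ENNReal,
    ∀ F : (Fin (n + 1) → ℝ) → ENNReal, Measurable F →
    ∫⁻ x, F (partialSums (n + 1) x) ∂Measure.pi (fun _ : Fin (n + 1) => expMeasure 1) =
      c * ∫⁻ t in Set.Ioi (0 : ℝ), ENNReal.ofReal (Real.exp (-t)) *
        ∫⁻ z in {z : Fin n → ℝ | StrictMono z} ∩ Set.univ.pi fun _ => Set.Ioo 0 t,
          F (Fin.snoc z t) := by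
  set L := partialSums (n + 1) with hL
  have hdet : LinearMap.det L ≠ 0 := by
    intro h
    have := LinearMap.bot_lt_ker_of_det_eq_zero h
    rw [LinearMap.ker_eq_bot.2 (partialSums_injective (n + 1))] at this
    exact lt_irrefl _ this
  refine ⟨ENNReal.ofReal |(LinearMap.det L)⁻¹|, fun F hF => ?_⟩
  have hLm : Measurable L := L.continuous_of_finiteDimensional.measurable
  have hFL : Measurable fun x => F (L x) := hF.comp hLm
  have hmap := Real.map_linearMap_volume_pi_eq_smul_volume_pi hdet
  set A : Set (ℝ × (Fin n → ℝ)) := {p | 0 < p.1 ∧ StrictMono p.2 ∧ ∀ i, p.2 i ∈ Set.Ioo 0 p.1}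
    with hA
  have hAm : MeasurableSet A := by
    refine (measurableSet_lt measurable_const measurable_fst).inter
      ((measurable_snd (measurableSet_strictMono n)).inter ?_)
    have : {p : ℝ × (Fin n → ℝ) | ∀ i, p.2 i ∈ Set.Ioo 0 p.1} =
        ⋂ i, ({p | 0 < p.2 i} ∩ {p | p.2 i < p.1}) := by
      ext p
      simp
    change MeasurableSet {p : ℝ × (Fin n → ℝ) | ∀ i, p.2 i ∈ Set.Ioo 0 p.1}
    rw [this]
    exact MeasurableSet.iInter fun i => (measurableSet_lt measurable_const (by fun_prop)).inter
      (measurableSet_lt (by fun_prop) (by fun_prop))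
  have hsn : Measurable fun p : ℝ × (Fin n → ℝ) =>
      (Fin.snoc p.2 p.1 : Fin (n + 1) → ℝ) := by
    refine measurable_pi_lambda _ fun i => ?_
    refine Fin.lastCases ?_ (fun i => ?_) i
    · simpa using measurable_fst
    · simp only [Fin.snoc_castSucc]
      fun_prop
  set K : ℝ × (Fin n → ℝ) → ENNReal := A.indicator fun p =>
    ENNReal.ofReal (Real.exp (-p.1)) * F (Fin.snoc p.2 p.1) with hK
  have hKm : Measurable K := by
    refine Measurable.indicator ?_ hAm
    exact (by fun_prop : Measurable fun p : ℝ × (Fin n → ℝ) =>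
      ENNReal.ofReal (Real.exp (-p.1))).mul (hF.comp hsn)
  set split := MeasurableEquiv.piFinSuccAbove (fun _ : Fin (n + 1) => ℝ) (Fin.last n) with hsplit
  have hsp1 : ∀ y, (split y).1 = y (Fin.last n) := fun y => rfl
  have hsp2 : ∀ y, (split y).2 = fun i : Fin n => y i.castSucc := fun y => by
    ext i
    change y ((Fin.last n).succAbove i) = _
    rw [Fin.succAbove_last]
  have hdens : ∀ x : Fin (n + 1) → ℝ, (∏ i, (Set.Ioi (0 : ℝ)).indicator
      (fun t => ENNReal.ofReal (Real.exp (-t))) (x i)) * F (L x) = K (split (L x)) := by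
    intro x
    have hiff : split (L x) ∈ A ↔ ∀ i, 0 < x i := by
      rw [forall_pos_iff_partialSums]
      simp only [hA, Set.mem_ofPred_eq, hsp1, hsp2, hL]
      tauto
    by_cases hx : ∀ i, 0 < x i
    · rw [hK, Set.indicator_of_mem (hiff.2 hx)]
      have e1 : (Fin.snoc (split (L x)).2 (split (L x)).1 : Fin (n + 1) → ℝ) = L x := by
        rw [hsp1, hsp2]
        exact Fin.snoc_init_self (L x)
      rw [e1]
      congr 1
      have e2 : (split (L x)).1 = ∑ i, x i := by
        rw [hsp1, hL, partialSums_apply]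
        congr 1
        ext i
        simp [Fin.le_last]
      rw [e2, ← Finset.sum_neg_distrib, Real.exp_sum,
        ENNReal.ofReal_prod_of_nonneg fun i _ => (Real.exp_pos _).le]
      exact Finset.prod_congr rfl fun i _ => Set.indicator_of_mem (hx i) _
    · rw [hK, Set.indicator_of_notMem (fun h => hx (hiff.1 h))]
      obtain ⟨i, hi⟩ := not_forall.1 hx
      rw [Finset.prod_eq_zero (Finset.mem_univ i) (Set.indicator_of_notMem hi _), zero_mul]
  rw [pi_expMeasure_eq, lintegral_withDensity_eq_lintegral_mul _ ?_ hFL]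
  swap
  · have hd : Measurable ((Set.Ioi (0 : ℝ)).indicator fun t => ENNReal.ofReal (Real.exp (-t))) :=
      Measurable.indicator (by fun_prop) measurableSet_Ioi
    exact Finset.measurable_fun_prod _ fun i _ => hd.comp (measurable_pi_apply i)
  calc _ = ∫⁻ x, K (split (L x)) := lintegral_congr hdens
    _ = ENNReal.ofReal |(LinearMap.det L)⁻¹| * ∫⁻ y, K (split y) := by
      have hKs : Measurable fun y => K (split y) := hKm.comp split.measurable
      rw [← lintegral_map hKs hLm, hmap, lintegral_smul_measure, smul_eq_mul,
        abs_inv]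
    _ = ENNReal.ofReal |(LinearMap.det L)⁻¹| * ∫⁻ p, K p := by
      rw [(volume_preserving_piFinSuccAbove (fun _ : Fin (n + 1) => ℝ)
        (Fin.last n)).lintegral_comp hKm]
    _ = _ := by
      congr 1
      rw [Measure.volume_eq_prod, lintegral_prod _ hKm.aemeasurable,
        ← lintegral_indicator measurableSet_Ioi]
      refine lintegral_congr fun t => ?_
      by_cases ht : t ∈ Set.Ioi (0 : ℝ)
      · have hBm : MeasurableSet ({z : Fin n → ℝ | StrictMono z} ∩
            Set.univ.pi fun _ => Set.Ioo 0 t) :=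
          (measurableSet_strictMono n).inter (MeasurableSet.univ_pi fun _ => measurableSet_Ioo)
        have hFm : Measurable fun z : Fin n → ℝ => F (Fin.snoc z t) :=
          hF.comp (hsn.comp (by fun_prop : Measurable fun z : Fin n → ℝ => (t, z)))
        rw [Set.indicator_of_mem ht, ← lintegral_const_mul _ hFm, ← lintegral_indicator hBm]
        refine lintegral_congr fun z => ?_
        have : (t, z) ∈ A ↔ z ∈ {z : Fin n → ℝ | StrictMono z} ∩
            Set.univ.pi fun _ => Set.Ioo 0 t := by
          simp only [hA, Set.mem_ofPred_eq, Set.mem_inter_iff, Set.mem_univ_pi]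
          exact ⟨fun h => h.2, fun h => ⟨ht, h⟩⟩
        exact indicator_eq_indicator_of_iff this rfl
      · rw [Set.indicator_of_notMem ht]
        refine (lintegral_congr fun z => ?_).trans lintegral_zero
        exact Set.indicator_of_notMem (fun h => ht h.1) _

/-- The normalized arrival times `Γ_1/Γ_{n+1}, …, Γ_n/Γ_{n+1}` are, as an unordered sample,
distributed like `n` independent uniform variables. -/
lemma lintegral_normalized_partialSums {n : ℕ} {Ψ : (Fin n → ℝ) → ENNReal}
    (hΨ : Measurable Ψ) (hsymm : ∀ (σ : Equiv.Perm (Fin n)) x, Ψ (x ∘ σ) = Ψ x) :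
    ∫⁻ x, Ψ (fun i => partialSums (n + 1) x i.castSucc / partialSums (n + 1) x (Fin.last n))
      ∂Measure.pi (fun _ : Fin (n + 1) => expMeasure 1) =
    ∫⁻ u, Ψ u ∂Measure.pi fun _ : Fin n => volume.restrict (Set.Ioo (0 : ℝ) 1) := by
  obtain ⟨c, hint⟩ := exists_lintegral_partialSums_eq n
  set U : Measure (Fin n → ℝ) := Measure.pi fun _ : Fin n => volume.restrict (Set.Ioo (0 : ℝ) 1)
    with hU
  have hUm : MeasurableSet (Set.univ.pi fun _ : Fin n => Set.Ioo (0 : ℝ) 1) :=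
    MeasurableSet.univ_pi fun _ => measurableSet_Ioo
  have hU2 : U = volume.restrict (Set.univ.pi fun _ : Fin n => Set.Ioo (0 : ℝ) 1) := by
    rw [hU, ← Measure.restrict_pi_pi]
    rfl
  -- both integrals are proportional to the integral over increasing vectors in the unit cube
  set I : ((Fin n → ℝ) → ENNReal) → ENNReal := fun Ψ =>
    ∫⁻ u in {z : Fin n → ℝ | StrictMono z} ∩ Set.univ.pi fun _ => Set.Ioo (0 : ℝ) 1, Ψ u with hI
  have hleft : ∀ Ψ : (Fin n → ℝ) → ENNReal, Measurable Ψ →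
      ∫⁻ x, Ψ (fun i => partialSums (n + 1) x i.castSucc / partialSums (n + 1) x (Fin.last n))
        ∂Measure.pi (fun _ : Fin (n + 1) => expMeasure 1) =
      (c * ∫⁻ t in Set.Ioi (0 : ℝ), ENNReal.ofReal (Real.exp (-t)) * ENNReal.ofReal (t ^ n)) *
        I Ψ := by
    intro Ψ hΨ
    have hm : Measurable fun y : Fin (n + 1) → ℝ =>
        Ψ fun i : Fin n => y i.castSucc / y (Fin.last n) := hΨ.comp (by fun_prop)
    refine (hint (fun y => Ψ fun i => y i.castSucc / y (Fin.last n)) hm).trans ?_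
    rw [mul_assoc, ← lintegral_mul_const _ (by fun_prop)]
    congr 1
    refine setLIntegral_congr_fun measurableSet_Ioi fun t ht => ?_
    have ht0 : (0 : ℝ) < t := ht
    simp only [Fin.snoc_castSucc, Fin.snoc_last]
    rw [mul_assoc]
    congr 1
    have hB : ∀ t : ℝ, MeasurableSet ({z : Fin n → ℝ | StrictMono z} ∩
        Set.univ.pi fun _ => Set.Ioo 0 t) := fun t =>
      (measurableSet_strictMono n).inter (MeasurableSet.univ_pi fun _ => measurableSet_Ioo)
    change _ = ENNReal.ofReal (t ^ n) * ∫⁻ u in _, Ψ u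
    rw [← lintegral_indicator (hB t), ← lintegral_indicator (hB 1),
      ← lintegral_comp_smul_fin (hΨ.indicator (hB 1)) ht0]
    refine lintegral_congr fun z => ?_
    have e1 : (fun i => z i / t) = t⁻¹ • z := by
      ext i
      simp [div_eq_inv_mul]
    have e2 : t⁻¹ • z ∈ ({z : Fin n → ℝ | StrictMono z} ∩ Set.univ.pi fun _ => Set.Ioo 0 1) ↔
        z ∈ ({z : Fin n → ℝ | StrictMono z} ∩ Set.univ.pi fun _ => Set.Ioo 0 t) := by
      rw [← e1]
      simp only [Set.mem_inter_iff, Set.mem_ofPred_eq, Set.mem_univ_pi, Set.mem_Ioo, StrictMono,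
        div_lt_div_iff_of_pos_right ht0, div_pos_iff_of_pos_right ht0, div_lt_one ht0]
    exact indicator_eq_indicator_of_iff e2.symm (congrArg Ψ e1)
  have hright : ∀ Ψ : (Fin n → ℝ) → ENNReal, Measurable Ψ →
      (∀ (σ : Equiv.Perm (Fin n)) x, Ψ (x ∘ σ) = Ψ x) →
      ∫⁻ u, Ψ u ∂U = n.factorial * I Ψ := by
    intro Ψ hΨ hsymm
    rw [hU2, ← lintegral_indicator hUm, lintegral_eq_factorial_mul_lintegral_strictMono
      (hΨ.indicator hUm), lintegral_indicator hUm, Measure.restrict_restrict hUm, Set.inter_comm]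
    intro σ x
    have : x ∘ σ ∈ (Set.univ.pi fun _ : Fin n => Set.Ioo (0 : ℝ) 1) ↔
        x ∈ (Set.univ.pi fun _ : Fin n => Set.Ioo (0 : ℝ) 1) := by
      simp only [Set.mem_univ_pi, Function.comp_apply]
      exact ⟨fun h i => by simpa using h (σ.symm i), fun h i => h (σ i)⟩
    exact indicator_eq_indicator_of_iff this (hsymm σ x)
  -- the constants agree because both measures have total mass one
  have hUp : IsProbabilityMeasure (volume.restrict (Set.Ioo (0 : ℝ) 1)) := ⟨by simp⟩
  have h1 := hleft (fun _ => 1) measurable_const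
  have h2 := hright (fun _ => 1) measurable_const fun _ _ => rfl
  simp only [lintegral_const, measure_univ, mul_one] at h1 h2
  have hI0 : I (fun _ => 1) ≠ 0 := fun h => by simp [h] at h2
  have hIt : I (fun _ => 1) ≠ ⊤ := fun h => by
    rw [h, ENNReal.mul_top (by exact_mod_cast n.factorial_ne_zero)] at h2
    exact ENNReal.one_ne_top h2
  have hcc := (ENNReal.mul_left_inj hI0 hIt).1 (h1.symm.trans h2)
  rw [hleft Ψ hΨ, hright Ψ hΨ hsymm, hcc]

/-- The probability integral transform for the absolute value of a Gaussian variable. -/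
lemma map_halfNormalTail_gaussianReal :
    (gaussianReal 0 1).map (fun x => halfNormalTail |x|) = volume.restrict (Set.Ioo (0 : ℝ) 1) := by
  have hm : Measurable fun x : ℝ => halfNormalTail |x| :=
    (continuous_halfNormalTail.comp continuous_abs).measurable
  have hp : IsProbabilityMeasure ((gaussianReal 0 1).map fun x => halfNormalTail |x|) :=
    Measure.isProbabilityMeasure_map hm.aemeasurable
  refine Measure.ext_of_Iic _ _ fun a => ?_
  rw [Measure.map_apply hm measurableSet_Iic, Measure.restrict_apply measurableSet_Iic]
  rcases le_or_gt a 0 with ha | ha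
  · have e1 : (fun x : ℝ => halfNormalTail |x|) ⁻¹' Set.Iic a = ∅ := by
      ext x
      simpa using ha.trans_lt (halfNormalTail_pos |x|)
    have e2 : Set.Iic a ∩ Set.Ioo (0 : ℝ) 1 = ∅ := by
      ext x
      simp only [Set.mem_inter_iff, Set.mem_Iic, Set.mem_Ioo, Set.mem_empty_iff_false, iff_false]
      rintro ⟨h1, h2, -⟩
      linarith
    rw [e1, e2, measure_empty, measure_empty]
  rcases lt_or_ge a 1 with ha1 | ha1
  · obtain ⟨q, hq, rfl⟩ := exists_halfNormalTail_eq ha ha1.le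
    have e1 : (fun x : ℝ => halfNormalTail |x|) ⁻¹' Set.Iic (halfNormalTail q) =
        (Set.Ioo (-q) q)ᶜ := by
      ext x
      simp only [Set.mem_preimage, Set.mem_Iic, strictAnti_halfNormalTail.le_iff_ge,
        Set.mem_compl_iff, Set.mem_Ioo, ← abs_lt, not_lt]
    have e2 : Set.Iic (halfNormalTail q) ∩ Set.Ioo (0 : ℝ) 1 = Set.Ioc 0 (halfNormalTail q) := by
      ext x
      simp only [Set.mem_inter_iff, Set.mem_Iic, Set.mem_Ioo, Set.mem_Ioc]
      exact ⟨fun h => ⟨h.2.1, h.1⟩, fun h => ⟨h.2, h.1, h.2.trans_lt ha1⟩⟩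
    have e3 : ∫ x in Set.Ioo (-q) q, gaussianPDFReal 0 1 x = 1 - halfNormalTail q := by
      rw [← integral_Ioc_eq_integral_Ioo, ← intervalIntegral.integral_of_le (by linarith)]
      have hint : ∀ a b, IntervalIntegrable (gaussianPDFReal 0 1) volume a b := fun a b =>
        (integrable_gaussianPDFReal 0 1).intervalIntegrable
      rw [← intervalIntegral.integral_add_adjacent_intervals (hint (-q) 0) (hint 0 q)]
      have e4 : ∫ x in (-q)..0, gaussianPDFReal 0 1 x =
          ∫ x in (0 : ℝ)..q, gaussianPDFReal 0 1 x := by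
        have := intervalIntegral.integral_comp_neg (a := 0) (b := q) (gaussianPDFReal 0 1)
        rw [neg_zero] at this
        rw [← this]
        refine intervalIntegral.integral_congr fun x _ => ?_
        simp [gaussianPDFReal]
      have e5 : ∫ x in (0 : ℝ)..q, gaussianPDFReal 0 1 x =
          (√(2 * Real.pi))⁻¹ * ∫ x in (0 : ℝ)..q, Real.exp (-(x ^ 2 / 2)) := by
        rw [← intervalIntegral.integral_const_mul]
        refine intervalIntegral.integral_congr fun x _ => ?_
        simp only [gaussianPDFReal, NNReal.coe_one, mul_one, sub_zero]
        ring_nf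
      have e6 : 2 * (√(2 * Real.pi))⁻¹ = √(2 / Real.pi) := by
        rw [Real.sqrt_mul (by norm_num), Real.sqrt_div (by norm_num)]
        have := Real.pi_pos
        have h2 : (2 : ℝ) = √2 * √2 := (Real.mul_self_sqrt (by norm_num)).symm
        field_simp
        rw [Real.sq_sqrt (by norm_num)]
      rw [e4, e5, halfNormalTail, ← e6]
      ring
    rw [e1, e2, prob_compl_eq_one_sub measurableSet_Ioo,
      gaussianReal_apply_eq_integral _ one_ne_zero, e3, Real.volume_Ioc, ← ENNReal.ofReal_one,
      ← ENNReal.ofReal_sub _ (by linarith)]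
    congr 1
    ring
  · have e1 : (fun x : ℝ => halfNormalTail |x|) ⁻¹' Set.Iic a = Set.univ := by
      ext x
      simpa using (halfNormalTail_le_one (abs_nonneg x)).trans ha1
    have e2 : Set.Iic a ∩ Set.Ioo (0 : ℝ) 1 = Set.Ioo 0 1 := by
      refine Set.inter_eq_right.2 fun x hx => ?_
      exact hx.2.le.trans ha1
    rw [e1, e2, measure_univ]
    simp

/-! ### Equality in law of the two statistics -/

section Laws

variable {Ω Ω' : Type*} [MeasurableSpace Ω] [MeasurableSpace Ω'] {μ : Measure Ω} {ν : Measure Ω'}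

lemma IsIID.map_fin_eq_pi [IsProbabilityMeasure μ] {X : ℕ → Ω → ℝ} {ρ : Measure ℝ}
    (hX : IsIID X ρ μ) (n : ℕ) :
    μ.map (fun ω (i : Fin n) => X i ω) = Measure.pi fun _ : Fin n => ρ := by
  have h := (iIndepFun_iff_map_fun_eq_pi_map (f := fun (i : Fin n) ω => X i ω)
    fun i => (hX.1 i).aemeasurable).1 (hX.2.precomp Fin.val_injective)
  rw [h]
  congr 1
  ext1 i
  exact (hX.1 i).map_eq

lemma sigmaSum_eq_sum_expQuantile (n : ℕ) (x : ℕ → ℝ) : sigmaSum n x =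
    (1 / (n : ℝ)) * ∑ i : Fin n, expQuantile (halfNormalTail |x i|) := by
  rw [sigmaSum, Finset.sum_range]
  congr 1
  refine Finset.sum_congr rfl fun i _ => ?_
  rw [expQuantile, halfNormalQuantile_halfNormalTail (abs_nonneg _), sq_abs]

lemma arrivalMean_eq_sum_fin (n : ℕ) (e : ℕ → ℝ) : arrivalMean n e =
    (1 / (n : ℝ)) * ∑ i : Fin n, expQuantile
      (partialSums (n + 1) (fun j => e j) i.castSucc /
        partialSums (n + 1) (fun j => e j) (Fin.last n)) := by
  rw [arrivalMean, Finset.sum_range]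
  simp_rw [partialSums_eq_sum_range]
  rfl

/-- The exponential mean of a Gaussian sample has the law of `arrivalMean`: both are the same
symmetric function of a sample of `n` uniform variables. -/
lemma map_arrivalMean_eq_map_sigmaSum [IsProbabilityMeasure μ] [IsProbabilityMeasure ν]
    {e : ℕ → Ω → ℝ} {ξ : ℕ → Ω' → ℝ} (he : IsIID e (expMeasure 1) μ)
    (hξ : IsIID ξ (gaussianReal 0 1) ν) (n : ℕ) :
    μ.map (fun ω => arrivalMean n fun s => e s ω) = ν.map fun ω => sigmaSum n fun i => ξ i ω := by
  have hem : AEMeasurable (fun ω (i : Fin (n + 1)) => e i ω) μ :=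
    aemeasurable_pi_lambda _ fun i => (he.1 i).aemeasurable
  have hξm : AEMeasurable (fun ω (i : Fin n) => ξ i ω) ν :=
    aemeasurable_pi_lambda _ fun i => (hξ.1 i).aemeasurable
  set Q : (Fin n → ℝ) → ℝ := fun u => (1 / (n : ℝ)) * ∑ i, expQuantile (u i) with hQ
  have hQm : Measurable Q := by fun_prop
  set R : (Fin (n + 1) → ℝ) → (Fin n → ℝ) := fun x i =>
    partialSums (n + 1) x i.castSucc / partialSums (n + 1) x (Fin.last n) with hR
  have hRm : Measurable R := by
    have : Measurable (partialSums (n + 1)) :=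
      (partialSums (n + 1)).continuous_of_finiteDimensional.measurable
    fun_prop
  set V : (Fin n → ℝ) → (Fin n → ℝ) := fun x i => halfNormalTail |x i| with hV
  have hT : Measurable fun x : ℝ => halfNormalTail |x| :=
    (continuous_halfNormalTail.comp continuous_abs).measurable
  have hVm : Measurable V := measurable_pi_lambda _ fun i => hT.comp (measurable_pi_apply i)
  have e1 : (fun ω => arrivalMean n fun s => e s ω) =
      (Q ∘ R) ∘ fun ω (i : Fin (n + 1)) => e i ω := by
    ext ω
    exact arrivalMean_eq_sum_fin n _
  have e2 : (fun ω => sigmaSum n fun i => ξ i ω) = (Q ∘ V) ∘ fun ω (i : Fin n) => ξ i ω := by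
    ext ω
    exact sigmaSum_eq_sum_expQuantile n _
  have hUp : IsProbabilityMeasure (volume.restrict (Set.Ioo (0 : ℝ) 1)) := ⟨by simp⟩
  have hVmap : (Measure.pi fun _ : Fin n => gaussianReal 0 1).map V =
      Measure.pi fun _ : Fin n => volume.restrict (Set.Ioo (0 : ℝ) 1) := by
    have := Measure.pi_map_pi (μ := fun _ : Fin n => gaussianReal 0 1)
      (f := fun _ x => halfNormalTail |x|)
      (hμ := fun _ => by rw [map_halfNormalTail_gaussianReal]; infer_instance)
      fun _ => hT.aemeasurable
    simpa only [map_halfNormalTail_gaussianReal] using this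
  rw [e1, e2, ← AEMeasurable.map_map_of_aemeasurable (hQm.comp hRm).aemeasurable hem,
    ← AEMeasurable.map_map_of_aemeasurable (hQm.comp hVm).aemeasurable hξm, he.map_fin_eq_pi,
    hξ.map_fin_eq_pi, ← Measure.map_map hQm hVm, hVmap]
  ext B hB
  rw [Measure.map_apply (hQm.comp hRm) hB, Measure.map_apply hQm hB]
  have hB1 : Measurable (B.indicator fun _ => (1 : ENNReal)) := measurable_const.indicator hB
  have h := lintegral_normalized_partialSums (n := n)
    (Ψ := fun u => B.indicator (fun _ => (1 : ENNReal)) (Q u)) (hB1.comp hQm) (fun σ x => by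
      have : Q (x ∘ σ) = Q x := by
        simp only [hQ, Function.comp_apply]
        rw [Equiv.sum_comp σ fun i => expQuantile (x i)]
      rw [this])
  have hind : ∀ {α : Type} (f : α → ℝ) (x : α), B.indicator (fun _ => (1 : ENNReal)) (f x) =
      (f ⁻¹' B).indicator 1 x := fun f x => rfl
  change ∫⁻ x, B.indicator (fun _ => (1 : ENNReal)) ((Q ∘ R) x) ∂_ = _ at h
  simp_rw [hind] at h
  rwa [lintegral_indicator_one (hQm.comp hRm hB), lintegral_indicator_one (hQm hB)] at h

end Laws

/-! ### Coupling through a common statistic -/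

/-- If `S n` under `α` has the law of `T n` under `β` for every `n`, there is one probability space
carrying a variable `X` of law `α`, and for each `n` a variable `Y n` of law `β` with
`T n (Y n) = S n X` almost surely: draw `Y n` from the conditional law of `β` given
`T n = S n X`, using one auxiliary uniform variable for all `n`. -/
lemma exists_coupling {A B : Type} [MeasurableSpace A] [MeasurableSpace B] [StandardBorelSpace B]
    [Nonempty B] (α : Measure A) (β : Measure B) [IsProbabilityMeasure α] [IsProbabilityMeasure β]
    {S : ℕ → A → ℝ} {T : ℕ → B → ℝ} (hS : ∀ n, Measurable (S n)) (hT : ∀ n, Measurable (T n))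
    (hlaw : ∀ n, α.map (S n) = β.map (T n)) :
    ∃ (Ω : Type) (_ : MeasurableSpace Ω) (μ : Measure Ω) (_ : IsProbabilityMeasure μ)
      (X : Ω → A) (Y : ℕ → Ω → B), Measurable X ∧ (∀ n, Measurable (Y n)) ∧
      μ.map X = α ∧ (∀ n, μ.map (Y n) = β) ∧ ∀ n, ∀ᵐ ω ∂μ, T n (Y n ω) = S n (X ω) := by
  choose f hfm hf using fun n =>
    (condDistrib (id : B → B) (T n) β).exists_measurable_map_eq_unitInterval
  have hYm : ∀ n, Measurable fun p : A × unitInterval => f n (S n p.1) p.2 := fun n =>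
    (hfm n).comp (((hS n).comp measurable_fst).prodMk measurable_snd)
  have hpm : ∀ n, Measurable fun p : A × unitInterval => (S n p.1, f n (S n p.1) p.2) := fun n =>
    ((hS n).comp measurable_fst).prodMk (hYm n)
  have hTp : ∀ n, Measurable fun b => (T n b, b) := fun n => (hT n).prodMk measurable_id
  -- the pair `(S n X, Y n)` has the law of `(T n, id)` under `β`
  have hpair : ∀ n, (α.prod (volume : Measure unitInterval)).map
      (fun p => (S n p.1, f n (S n p.1) p.2)) = β.map fun b => (T n b, b) := by
    intro n
    have h1 := compProd_map_condDistrib (mβ := Real.measurableSpace)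
      (X := T n) (Y := (id : B → B)) (μ := β) aemeasurable_id
    simp only [id] at h1
    rw [← h1, ← hlaw n]
    ext C hC
    rw [Measure.map_apply (hpm n) hC, Measure.compProd_apply hC, Measure.prod_apply (hpm n hC),
      lintegral_map (Kernel.measurable_kernel_prodMk_left hC) (hS n)]
    refine lintegral_congr fun a => ?_
    have hfa : Measurable (f n (S n a)) := (hfm n).comp measurable_prodMk_left
    rw [← hf n (S n a), Measure.map_apply hfa (measurable_prodMk_left hC)]
    rfl
  refine ⟨A × unitInterval, inferInstance, α.prod volume, inferInstance, Prod.fst,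
    fun n p => f n (S n p.1) p.2, measurable_fst, hYm, ?_, fun n => ?_, fun n => ?_⟩
  · simp
  · have h := congrArg (Measure.map Prod.snd) (hpair n)
    rw [Measure.map_map measurable_snd (hpm n),
      Measure.map_map measurable_snd (hTp n)] at h
    refine h.trans ?_
    change β.map id = β
    exact Measure.map_id
  · have hd : MeasurableSet {q : ℝ × B | T n q.2 = q.1} :=
      measurableSet_eq_fun ((hT n).comp measurable_snd) measurable_fst
    have h2 : ∀ᵐ q ∂(β.map fun b => (T n b, b)), T n q.2 = q.1 :=
      (ae_map_iff (hTp n).aemeasurable hd).2 (ae_of_all _ fun b => rfl)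
    rw [← hpair n] at h2
    exact ae_of_ae_map (hpm n).aemeasurable h2

lemma isIID_eval (ρ : Measure ℝ) [IsProbabilityMeasure ρ] :
    IsIID (fun i (x : ℕ → ℝ) => x i) ρ (Measure.infinitePi fun _ => ρ) :=
  ⟨fun i => ⟨(measurable_pi_apply i).aemeasurable, Measure.infinitePi_map_eval _ i⟩,
    iIndepFun_infinitePi (X := fun _ x => x) fun _ => measurable_id⟩

lemma isIID_of_map_eq {Ω : Type*} [MeasurableSpace Ω] {μ : Measure Ω} {ρ : Measure ℝ}
    [IsProbabilityMeasure ρ] [IsProbabilityMeasure μ] {X : Ω → ℕ → ℝ} (hX : Measurable X)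
    (h : μ.map X = Measure.infinitePi fun _ => ρ) : IsIID (fun i ω => X ω i) ρ μ := by
  have hXm : ∀ i, Measurable fun ω => X ω i := fun i => (measurable_pi_apply i).comp hX
  have hXi : ∀ i, μ.map (fun ω => X ω i) = ρ := fun i => by
    have := congrArg (Measure.map fun x : ℕ → ℝ => x i) h
    rwa [Measure.map_map (measurable_pi_apply i) hX, Measure.infinitePi_map_eval] at this
  refine ⟨fun i => ⟨(hXm i).aemeasurable, hXi i⟩, ?_⟩
  rw [iIndepFun_iff_map_fun_eq_infinitePi_map hXm]
  simp_rw [hXi]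
  exact h

lemma measurable_sigmaSum (n : ℕ) : Measurable (sigmaSum n) := by unfold sigmaSum; fun_prop

lemma measurable_arrivalMean (n : ℕ) : Measurable (arrivalMean n) := by
  unfold arrivalMean; fun_prop

/-- Convergence in probability only depends on the laws: it passes from `arrivalMean` of the
canonical exponential sequence to Gaussian samples coupled with copies of that sequence. -/
lemma eqInProbUpTo_of_coupling {Ω : Type*} [MeasurableSpace Ω] {μ : Measure Ω}
    {ξ e : ℕ → Ω → ℕ → ℝ} (he : ∀ n, Measurable (e n))
    (hlaw : ∀ n, μ.map (e n) = Measure.infinitePi fun _ => expMeasure 1)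
    (hae : ∀ n, ∀ᵐ ω ∂μ, sigmaSum n (ξ n ω) = arrivalMean n (e n ω)) :
    EqInProbUpTo μ (fun n ω => sigmaSum n (ξ n ω))
      (fun n ω => √(2 / Real.pi) * (bSeq n + zetaCirc (e n ω) / bSeq n))
      (fun n => 1 / √(Real.log n)) := by
  intro ε hε
  have h := (isIID_eval (expMeasure 1)).eqInProbUpTo_arrivalMean ε hε
  refine tendsto_of_tendsto_of_tendsto_of_le_of_le tendsto_const_nhds h (fun _ => zero_le)
    fun n => ?_
  set s : Set (ℕ → ℝ) := {x | ε ≤ |arrivalMean n x -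
    √(2 / Real.pi) * (bSeq n + zetaCirc x / bSeq n)| / (1 / √(Real.log n))} with hs
  calc _ ≤ μ (e n ⁻¹' s) := by
        refine measure_mono_ae ?_
        filter_upwards [hae n] with ω hω hmem
        change ε ≤ _ at hmem
        change ε ≤ _
        rwa [hω] at hmem
    _ ≤ (μ.map (e n)) s := Measure.le_map_apply (he n).aemeasurable s
    _ = _ := by rw [hlaw n]

theorem theorem3 :
    -- the series defining `ζ°` converges (absolutely) almost surely
    (∀ (Ω : Type*) [MeasurableSpace Ω] (μ : Measure Ω) [IsProbabilityMeasure μ]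
        (e : ℕ → Ω → ℝ), IsIID e (expMeasure 1) μ →
        ∀ᵐ ω ∂μ, Summable (zetaTerm (fun s => e s ω))) ∧
    -- coupling with one variable `ζ°`, and a Gaussian sequence `ξ n` for each `n`
    (∃ (Ω : Type) (_ : MeasurableSpace Ω) (μ : Measure Ω) (_ : IsProbabilityMeasure μ)
        (ξ : ℕ → ℕ → Ω → ℝ) (e : ℕ → Ω → ℝ),
        (∀ n, IsIID (ξ n) (gaussianReal 0 1) μ) ∧ IsIID e (expMeasure 1) μ ∧
        EqInProbUpTo μ
          (fun n ω => sigmaSum n (fun i => ξ n i ω))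
          (fun n ω => Real.sqrt (2 / Real.pi) *
            (bSeq n + zetaCirc (fun s => e s ω) / bSeq n))
          (fun n => 1 / Real.sqrt (Real.log (n : ℝ)))) ∧
    -- coupling with one Gaussian sequence `ξ`, and a copy of `ζ°` for each `n`
    (∃ (Ω : Type) (_ : MeasurableSpace Ω) (μ : Measure Ω) (_ : IsProbabilityMeasure μ)
        (ξ : ℕ → Ω → ℝ) (e : ℕ → ℕ → Ω → ℝ),
        IsIID ξ (gaussianReal 0 1) μ ∧ (∀ n, IsIID (e n) (expMeasure 1) μ) ∧
        EqInProbUpTo μ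
          (fun n ω => sigmaSum n (fun i => ξ i ω))
          (fun n ω => Real.sqrt (2 / Real.pi) *
            (bSeq n + zetaCirc (fun s => e n s ω) / bSeq n))
          (fun n => 1 / Real.sqrt (Real.log (n : ℝ)))) := by
  have hlaw := map_arrivalMean_eq_map_sigmaSum (isIID_eval (expMeasure 1))
    (isIID_eval (gaussianReal 0 1))
  refine ⟨fun Ω _ μ _ e he => he.ae_summable_zetaTerm, ?_, ?_⟩
  · obtain ⟨Ω, mΩ, μ, hμ, e, ξ, hem, hξm, he, hξ, hae⟩ := exists_coupling
      (Measure.infinitePi fun _ : ℕ => expMeasure 1)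
      (Measure.infinitePi fun _ : ℕ => gaussianReal 0 1)
      measurable_arrivalMean measurable_sigmaSum hlaw
    exact ⟨Ω, mΩ, μ, hμ, fun n i ω => ξ n ω i, fun s ω => e ω s,
      fun n => isIID_of_map_eq (hξm n) (hξ n), isIID_of_map_eq hem he,
      eqInProbUpTo_of_coupling (e := fun _ => e) (fun _ => hem) (fun _ => he) hae⟩
  · obtain ⟨Ω, mΩ, μ, hμ, ξ, e, hξm, hem, hξ, he, hae⟩ := exists_coupling
      (Measure.infinitePi fun _ : ℕ => gaussianReal 0 1)
      (Measure.infinitePi fun _ : ℕ => expMeasure 1)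
      measurable_sigmaSum measurable_arrivalMean fun n => (hlaw n).symm
    exact ⟨Ω, mΩ, μ, hμ, fun i ω => ξ ω i, fun n s ω => e n ω s,
      isIID_of_map_eq hξm hξ, fun n => isIID_of_map_eq (hem n) (he n),
      eqInProbUpTo_of_coupling (ξ := fun _ => ξ) hem he fun n => (hae n).mono fun _ h => h.symm⟩
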